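/- **Setting.** Let $Q$ be a smooth manifold of dimension $m$ and let $i\colon N\hookrightarrow Q$ be an embedded smooth submanifold of dimension $n<m$ given by $N=\{q\in Q : \phi^\alpha(q)=0,\ 1\le\alpha\le m-n\}$, where the $\phi^\alpha\colon Q\to\mathbb R$ are smooth and the differentials $d\phi^1(q),\dots,d\phi^{m-n}(q)$ are linearly independent at every $q\in N$. Let $L\colon TN\to\mathbb R$ be a smooth regular Lagrangian (its fibre Hessian $\partial^2L/\partial\dot x^a\partial\dot x^b$ is nondegenerate everywhere), and let $\tilde L\colon TQ\to\mathbb R$ be an arbitrary smooth extension, $\tilde L\circ Ti=L$. Let $I\subseteq\mathbb R$ be a nonempty open interval. All base curves are of class $C^2$ on $I$; multipliers are arbitrary functions $I\to\mathbb R^{m-n}$ unless more is said. All equations are required at every $t\in I$, in every smooth chart around the point concerned. Sums over repeated indices are understood. For a Lagrangian $\ell$ write $\mathbb F\ell(v)=\partial\ell/\partial v$ for its fibre derivative and $E_\ell(v)=\langle\mathbb F\ell(v),v\rangle-\ell(v)$ for its energy. *Intrinsic dynamics.* Curves $x\colon I\to N$ with $$\frac{d}{dt}\frac{\partial L}{\partial\dot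 x^a}-\frac{\partial L}{\partial x^a}=0.\tag{1}$$ *Extrinsic dynamics.* Curves $q\colon I\to Q$ for which there are multipliers $\Lambda_\alpha(t)$ with $$\frac{d}{dt}\frac{\partial\tilde L}{\partial\dot q^i}-\frac{\partial\tilde L}{\partial q^i}=-\Lambda_\alpha\frac{\partial\phi^\alpha}{\partial q^i},\qquad \phi^\alpha(q)=0.\tag{2}$$ **Proposition.** The two dynamics are equivalent. Precisely: 1. A curve $x\colon I\to N$ satisfies (1) if and only if it satisfies Hamilton's principle: for all $[a,b]\subset I$ it is a critical point of $\int_a^bL(x,\dot x)\,dt$ among $C^2$ variations with fixed end points. 2. Let $U\subseteq TN$ be open and let $H$ be a function on $T^*N$ with $H\circ\mathbb FL=E_L$ on $U$. A curve $(x,p)\colon I\to T^*N$ lies in $\mathbb FL(U)$ and solves Hamilton's equations $\dot x^a=\partial H/\partial p_a$, $\dot p_a=-\partial H/\partial x^a$ if and only if $(x,\dot x)\in U$ and $p=\mathbb FL(x,\dot x)$ on $I$, and $x$ satisfies (1). 3. A curve $x\colon I\to N$ satisfies (1) if and only if $q=i\circ x$ satisfies (2) for some multipliers $\Lambda$. 4.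 Every solution $q$ of (2) is of the form $q=i\circ x$ with $x\colon I\to N$ a $C^2$ solution of (1). 5. The solution curves in $TN$ coincide: a curve $V\colon I\to TN$ is $(x,\dot x)$ for a solution $x$ of (1) if and only if $Ti\circ V$ is $(q,\dot q)$ for a solution $q$ of (2) (with some $\Lambda$). 6. Let $\tilde U\subseteq TQ$ be open, let $\tilde L$ be regular on $\tilde U$, and let $\tilde H$ be a function on $T^*Q$ with $\tilde H\circ\mathbb F\tilde L=E_{\tilde L}$ on $\tilde U$. A curve $(q,p)\colon I\to T^*Q$ lies in $\mathbb F\tilde L(\tilde U)$ and solves $$\dot q^i=\frac{\partial\tilde H}{\partial p_i},\qquad \dot p_i=-\frac{\partial\tilde H}{\partial q^i}-\Lambda_\alpha\frac{\partial\phi^\alpha}{\partial q^i},\qquad\phi^\alpha(q)=0$$ if and only if $(q,\dot q)\in\tilde U$ and $p=\mathbb F\tilde L(q,\dot q)$ on $I$, and $q$ satisfies (2) with the same $\Lambda$. 7. *Multipliers.* For a curve $q\colon I\to Q$ consider the equations with two families of multipliers $\lambda_\alpha,\tilde\lambda_\alpha$, for the constraints $\phi^\alpha(q)=0$ and $\frac{\partial\phi^\alpha}{\partial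 q^i}\dot q^i=0$: $$p_i=\frac{\partial\tilde L}{\partial\dot q^i}+\tilde\lambda_\alpha\frac{\partial\phi^\alpha}{\partial q^i},\qquad \dot p_i=\frac{\partial\tilde L}{\partial q^i}+\lambda_\alpha\frac{\partial\phi^\alpha}{\partial q^i}+\tilde\lambda_\alpha\frac{\partial^2\phi^\alpha}{\partial q^i\partial q^j}\dot q^j,\qquad \phi^\alpha(q)=0,\quad \frac{\partial\phi^\alpha}{\partial q^i}\dot q^i=0.\tag{3}$$ Then (3) holds if and only if $\tilde\lambda$ is differentiable on $I$ and $q$ satisfies (2) with $\Lambda_\alpha=\frac{d}{dt}\tilde\lambda_\alpha-\lambda_\alpha$. If $q$ satisfies (2) with $\Lambda$, then $\Lambda$ is continuous and uniquely determined on $I$ by $q$ and $\tilde L$, but $(\lambda,\tilde\lambda)$ is not unique: there are two pairs $(\lambda^1,\tilde\lambda^1)$, $(\lambda^2,\tilde\lambda^2)$ satisfying (3) with $\lambda^1(t)\ne\lambda^2(t)$ and $\tilde\lambda^1(t)\ne\tilde\lambda^2(t)$ for all $t\in I$. -/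

import Mathlib

open Set Topology
open scoped Manifold ContDiff

noncomputable section

namespace HolonomicDynamics

section

variable {E : Type*} [NormedAddCommGroup E] [NormedSpace ℝ E]
  {M : Type*} [TopologicalSpace M] [ChartedSpace E M]

/-- The total space of the cotangent bundle `T*M` of a manifold `M` modelled on `E`. -/
abbrev CotangentBundle (E : Type*) [NormedAddCommGroup E] [NormedSpace ℝ E]
    (M : Type*) [TopologicalSpace M] [ChartedSpace E M] : Type _ :=
  Bundle.TotalSpace (E →L[ℝ] ℝ) (fun x : M => TangentSpace 𝓘(ℝ, E) x →L[ℝ] ℝ)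

/-- The differential of a real function at `q`, as an element of `T*_q M`. -/
def differential (E : Type*) [NormedAddCommGroup E] [NormedSpace ℝ E]
    {M : Type*} [TopologicalSpace M] [ChartedSpace E M] (f : M → ℝ) (q : M) :
    TangentSpace 𝓘(ℝ, E) q →L[ℝ] ℝ :=
  mfderiv 𝓘(ℝ, E) 𝓘(ℝ, ℝ) f q

/-- The curve `t ↦ (x(t), ẋ(t))` in `TM` determined by a curve `x` in `M`. -/
def velocityLift (x : ℝ → M) (t : ℝ) : TangentBundle 𝓘(ℝ, E) M :=
  ⟨x t, mfderiv 𝓘(ℝ, ℝ) 𝓘(ℝ, E) x t (1 : ℝ)⟩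

/-- The fibre derivative (Legendre map) `FL : TM → T*M`, `(x, v) ↦ (x, ∂L/∂v (x, v))`. -/
def legendreMap (L : TangentBundle 𝓘(ℝ, E) M → ℝ) (v : TangentBundle 𝓘(ℝ, E) M) :
    CotangentBundle E M :=
  ⟨v.1, fderiv ℝ (fun w : TangentSpace 𝓘(ℝ, E) v.1 => L ⟨v.1, w⟩) v.2⟩

/-- The energy `⟨FL(v), v⟩ - L(v)` of a Lagrangian. -/
def energy (L : TangentBundle 𝓘(ℝ, E) M → ℝ) (v : TangentBundle 𝓘(ℝ, E) M) : ℝ :=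
  (legendreMap L v).2 v.2 - L v

/-- `L` is regular at the points of `U`: the fibre Hessian `∂²L/∂v∂v` is nondegenerate there. -/
def IsRegularOn (L : TangentBundle 𝓘(ℝ, E) M → ℝ) (U : Set (TangentBundle 𝓘(ℝ, E) M)) : Prop :=
  ∀ v ∈ U, ∀ u : TangentSpace 𝓘(ℝ, E) v.1,
    (∀ w : TangentSpace 𝓘(ℝ, E) v.1,
      fderiv ℝ (fun v' : TangentSpace 𝓘(ℝ, E) v.1 =>
        fderiv ℝ (fun v'' : TangentSpace 𝓘(ℝ, E) v.1 => L ⟨v.1, v''⟩) v' w) v.2 u = 0) →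
    u = 0

/-- `H` is, on `FL(U)`, the Legendre transform of the energy of `L`: `H ∘ FL = E_L` on `U`. -/
def IsLegendreTransformOn (L : TangentBundle 𝓘(ℝ, E) M → ℝ)
    (U : Set (TangentBundle 𝓘(ℝ, E) M)) (H : CotangentBundle E M → ℝ) : Prop :=
  ∀ v ∈ U, H (legendreMap L v) = energy L v

/-! ### Local expressions in a chart `e` -/

/-- A Lagrangian in the coordinates `(y, w)` of `TM` induced by a chart. -/
def localLagrangian (L : TangentBundle 𝓘(ℝ, E) M → ℝ) (e : OpenPartialHomeomorph M E)
    (y w : E) : ℝ :=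
  L ⟨e.symm y, mfderiv 𝓘(ℝ, E) 𝓘(ℝ, E) e.symm y w⟩

/-- `∂L/∂x` along the curve `x`, in the chart `e`. -/
def dLdx (L : TangentBundle 𝓘(ℝ, E) M → ℝ) (e : OpenPartialHomeomorph M E)
    (x : ℝ → M) (t : ℝ) : E →L[ℝ] ℝ :=
  fderiv ℝ (fun y => localLagrangian L e y (deriv (fun s => e (x s)) t)) (e (x t))

/-- `∂L/∂ẋ` along the curve `x`, in the chart `e`. -/
def dLdv (L : TangentBundle 𝓘(ℝ, E) M → ℝ) (e : OpenPartialHomeomorph M E)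
    (x : ℝ → M) (t : ℝ) : E →L[ℝ] ℝ :=
  fderiv ℝ (fun w => localLagrangian L e (e (x t)) w) (deriv (fun s => e (x s)) t)

/-- The momentum coordinates of a covector, in the chart `e`. -/
def momentumCoord (e : OpenPartialHomeomorph M E) (p : CotangentBundle E M) : E →L[ℝ] ℝ :=
  p.2 ∘L (mfderiv 𝓘(ℝ, E) 𝓘(ℝ, E) e p.1).inverse

/-- A Hamiltonian in the coordinates `(y, π)` of `T*M` induced by a chart. -/
def localHamiltonian (H : CotangentBundle E M → ℝ) (e : OpenPartialHomeomorph M E)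
    (y : E) (π : E →L[ℝ] ℝ) : ℝ :=
  H ⟨e.symm y, π ∘L mfderiv 𝓘(ℝ, E) 𝓘(ℝ, E) e (e.symm y)⟩

/-- `∂H/∂x` at the covector `p`, in the chart `e`. -/
def dHdx (H : CotangentBundle E M → ℝ) (e : OpenPartialHomeomorph M E)
    (p : CotangentBundle E M) : E →L[ℝ] ℝ :=
  fderiv ℝ (fun y => localHamiltonian H e y (momentumCoord e p)) (e p.1)

/-- `∂H/∂p` at the covector `p`, in the chart `e`, as a linear form on covectors. -/
def dHdp (H : CotangentBundle E M → ℝ) (e : OpenPartialHomeomorph M E)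
    (p : CotangentBundle E M) : (E →L[ℝ] ℝ) →L[ℝ] ℝ :=
  fderiv ℝ (fun π => localHamiltonian H e (e p.1) π) (momentumCoord e p)

/-- The differential of a function at `q`, in the chart `e`. -/
def dFun (f : M → ℝ) (e : OpenPartialHomeomorph M E) (q : M) : E →L[ℝ] ℝ :=
  fderiv ℝ (fun y => f (e.symm y)) (e q)

/-- The second derivative of a function at `q`, in the chart `e`. -/
def ddFun (f : M → ℝ) (e : OpenPartialHomeomorph M E) (q : M) : E →L[ℝ] E →L[ℝ] ℝ :=
  fderiv ℝ (fderiv ℝ (fun y => f (e.symm y))) (e q)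

/-! ### Intrinsic dynamics -/

/-- Hamilton's principle on the time set `I`: for all `[a, b] ⊆ I` the curve `x` is a critical
point of `∫ₐᵇ L(x, ẋ) dt` with respect to all `C²` variations with fixed end points. -/
def IsCriticalCurve (L : TangentBundle 𝓘(ℝ, E) M → ℝ) (I : Set ℝ) (x : ℝ → M) : Prop :=
  ∀ a b : ℝ, a < b → Icc a b ⊆ I → ∀ (ε : ℝ) (X : ℝ → ℝ → M), 0 < ε →
    ContMDiffOn 𝓘(ℝ, ℝ × ℝ) 𝓘(ℝ, E) 2 (fun z : ℝ × ℝ => X z.1 z.2) (Ioo (-ε) ε ×ˢ I) →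
    (∀ t ∈ I, X 0 t = x t) →
    (∀ s ∈ Ioo (-ε) ε, X s a = x a ∧ X s b = x b) →
    HasDerivAt (fun s => ∫ t in a..b, L (velocityLift (X s) t)) 0 0

/-- The Euler-Lagrange equations `d/dt (∂L/∂ẋ) - ∂L/∂x = 0` in all charts, at all times of `I`. -/
def IsEulerLagrange (L : TangentBundle 𝓘(ℝ, E) M → ℝ) (I : Set ℝ) (x : ℝ → M) : Prop :=
  ∀ t ∈ I, ∀ e ∈ IsManifold.maximalAtlas 𝓘(ℝ, E) ∞ M, x t ∈ e.source →
    HasDerivAt (dLdv L e x) (dLdx L e x t) t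

/-- Hamilton's equations `ẋ = ∂H/∂p`, `ṗ = -∂H/∂x` for a curve `P = (x, p)` in `T*M`. -/
def IsHamilton (H : CotangentBundle E M → ℝ) (I : Set ℝ) (P : ℝ → CotangentBundle E M) : Prop :=
  ContinuousOn (fun t => (P t).1) I ∧
  ∀ t ∈ I, ∀ e ∈ IsManifold.maximalAtlas 𝓘(ℝ, E) ∞ M, (P t).1 ∈ e.source →
    (∃ y' : E, HasDerivAt (fun s => e (P s).1) y' t ∧ ∀ η : E →L[ℝ] ℝ, η y' = dHdp H e (P t) η) ∧
    HasDerivAt (fun s => momentumCoord e (P s)) (-dHdx H e (P t)) t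

/-! ### Extrinsic dynamics, with constraints `φ α = 0` -/

/-- The constrained Euler-Lagrange equations
`d/dt (∂L/∂q̇) - ∂L/∂q = - Λ_α ∂φ^α/∂q`, `φ^α(q) = 0`. -/
def IsConstrainedEulerLagrange {k : ℕ} (L : TangentBundle 𝓘(ℝ, E) M → ℝ) (φ : Fin k → M → ℝ)
    (I : Set ℝ) (q : ℝ → M) (Λ : ℝ → Fin k → ℝ) : Prop :=
  ∀ t ∈ I, (∀ α, φ α (q t) = 0) ∧
    ∀ e ∈ IsManifold.maximalAtlas 𝓘(ℝ, E) ∞ M, q t ∈ e.source →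
      HasDerivAt (dLdv L e q) (dLdx L e q t - ∑ α, Λ t α • dFun (φ α) e (q t)) t

/-- The constrained Hamilton equations
`q̇ = ∂H/∂p`, `ṗ = -∂H/∂q - Λ_α ∂φ^α/∂q`, `φ^α(q) = 0` for a curve `P = (q, p)` in `T*M`. -/
def IsConstrainedHamilton {k : ℕ} (H : CotangentBundle E M → ℝ) (φ : Fin k → M → ℝ)
    (I : Set ℝ) (P : ℝ → CotangentBundle E M) (Λ : ℝ → Fin k → ℝ) : Prop :=
  ContinuousOn (fun t => (P t).1) I ∧
  ∀ t ∈ I, (∀ α, φ α (P t).1 = 0) ∧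
    ∀ e ∈ IsManifold.maximalAtlas 𝓘(ℝ, E) ∞ M, (P t).1 ∈ e.source →
      (∃ y' : E, HasDerivAt (fun s => e (P s).1) y' t ∧
        ∀ η : E →L[ℝ] ℝ, η y' = dHdp H e (P t) η) ∧
      HasDerivAt (fun s => momentumCoord e (P s))
        (-dHdx H e (P t) - ∑ α, Λ t α • dFun (φ α) e (P t).1) t

/-- The constrained equations with two families of multipliers, one for the constraints
`φ^α(q) = 0` and one for their time derivatives `∂φ^α/∂q^j q̇^j = 0`:
`p = ∂L/∂q̇ + μ_α ∂φ^α/∂q` and `ṗ = ∂L/∂q + lam_α ∂φ^α/∂q + μ_α ∂²φ^α/∂q∂q^j q̇^j`. -/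
def IsTwoMultiplierSolution {k : ℕ} (L : TangentBundle 𝓘(ℝ, E) M → ℝ) (φ : Fin k → M → ℝ)
    (I : Set ℝ) (q : ℝ → M) (lam μ : ℝ → Fin k → ℝ) : Prop :=
  ∀ t ∈ I, (∀ α, φ α (q t) = 0) ∧
    ∀ e ∈ IsManifold.maximalAtlas 𝓘(ℝ, E) ∞ M, q t ∈ e.source →
      (∀ α, dFun (φ α) e (q t) (deriv (fun s => e (q s)) t) = 0) ∧
      HasDerivAt (fun s => dLdv L e q s + ∑ α, μ s α • dFun (φ α) e (q s))
        (dLdx L e q t + ∑ α, lam t α • dFun (φ α) e (q t)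
          + ∑ α, μ t α • ddFun (φ α) e (q t) (deriv (fun s => e (q s)) t)) t

end

end HolonomicDynamics

end

open HolonomicDynamics

noncomputable section

namespace HolonomicDynamics


/-! ### Lagrangians on a normed space -/

section VectorSpace

variable {E : Type*} [NormedAddCommGroup E] [NormedSpace ℝ E]
  {E' : Type*} [NormedAddCommGroup E'] [NormedSpace ℝ E']

/-! The heart of the matter is that the Euler-Lagrange expression d/dt ∂L/∂ẋ - ∂L/∂x is a covector
along the curve and is natural: if ℓ = ℓ' ∘ Tj, then the expression of ℓ along c is that of ℓ' along
j ∘ c, pulled back by Dj (`hasDerivAt_fiberDeriv_pullback`, on manifolds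
`hasDerivAt_dLdv_pullback`). The product rule on one side and the chain rule on the other each
produce a term in D²j, and these cancel by symmetry. For j the identity read in two charts, this
says that the equations need only be checked in one chart. For j the inclusion i, it says that the
intrinsic expression is the restriction to TN of the extrinsic one. Hence x is an intrinsic solution
exactly when the extrinsic expression annihilates the image of Ti. The forms dφ^α are independent,
vanish on that image and are as many as its codimension, so they span its annihilator
(`exists_eq_sum_of_comp_eq_zero`), and the coefficients are the multipliers. Conversely, a
constrained curve in Q is a C² curve in N because i is a topological embedding with smooth local
left inverses.

On the Hamiltonian side, H is only known through H ∘ FL = E_L on U. Nondegeneracy of the fibre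
Hessian and the inverse function theorem make FL a local diffeomorphism, so H is differentiable at
the points of FL(U), with partial derivatives ẋ and -∂L/∂x (`hasFDerivAt_legendreTransform`). The
two systems then coincide term by term, with or without a constraint force.

For the two families of multipliers, d/dt (μ_α dφ^α) = μ'_α dφ^α + μ_α d²φ^α(q̇), which turns one
system into the other. That μ is differentiable, and that Λ is continuous, follows because
coefficients with respect to independent vectors depend smoothly on the vectors
(`exists_coefficient_map`).

Hamilton's principle is the first variation formula: the time derivative of momentum paired with the
variation field is the variation of L plus the Euler-Lagrange residual paired with that field.
Integration over [a, b] with fixed ends gives one direction, a bump variation inside a chart the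
other. -/

/-- The derivative of `ℓ (y, w)` in the velocity `w`. -/
def fiberDeriv (ℓ : E → E → ℝ) (z : E × E) : E →L[ℝ] ℝ := fderiv ℝ (ℓ z.1) z.2

/-- The derivative of `ℓ (y, w)` in the position `y`. -/
def baseDeriv (ℓ : E → E → ℝ) (z : E × E) : E →L[ℝ] ℝ := fderiv ℝ (fun y => ℓ y z.2) z.1

theorem fiberDeriv_eq {ℓ : E → E → ℝ} {z : E × E}
    (h : DifferentiableAt ℝ (fun z : E × E => ℓ z.1 z.2) z) :
    fiberDeriv ℓ z = fderiv ℝ (fun z : E × E => ℓ z.1 z.2) z ∘L ContinuousLinearMap.inr ℝ E E :=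
  (h.hasFDerivAt.comp (f := fun w => (z.1, w)) z.2 (hasFDerivAt_prodMk_right z.1 z.2)).fderiv

theorem baseDeriv_eq {ℓ : E → E → ℝ} {z : E × E}
    (h : DifferentiableAt ℝ (fun z : E × E => ℓ z.1 z.2) z) :
    baseDeriv ℓ z = fderiv ℝ (fun z : E × E => ℓ z.1 z.2) z ∘L ContinuousLinearMap.inl ℝ E E :=
  (h.hasFDerivAt.comp (f := fun y => (y, z.2)) z.1 (hasFDerivAt_prodMk_left z.1 z.2)).fderiv

theorem fderiv_lagrangian_apply {ℓ : E → E → ℝ} {z : E × E}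
    (h : DifferentiableAt ℝ (fun z : E × E => ℓ z.1 z.2) z) (u w : E) :
    fderiv ℝ (fun z : E × E => ℓ z.1 z.2) z (u, w) = baseDeriv ℓ z u + fiberDeriv ℓ z w := by
  rw [fiberDeriv_eq h, baseDeriv_eq h]
  simp [← map_add]

theorem _root_.ContDiffAt.eventually_differentiableAt {f : E → E'} {z : E}
    (h : ContDiffAt ℝ ∞ f z) : ∀ᶠ z' in 𝓝 z, DifferentiableAt ℝ f z' :=
  ((h.of_le (m := 1) (mod_cast le_top)).eventually (by simp)).mono
    fun _ h' => h'.differentiableAt one_ne_zero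

theorem contDiffAt_fiberDeriv {ℓ : E → E → ℝ} {z : E × E}
    (h : ContDiffAt ℝ ∞ (fun z : E × E => ℓ z.1 z.2) z) :
    ContDiffAt ℝ ∞ (fiberDeriv ℓ) z := by
  have h1 : ContDiffAt ℝ ∞ (fun z' => fderiv ℝ (fun z : E × E => ℓ z.1 z.2) z' ∘L
      ContinuousLinearMap.inr ℝ E E) z :=
    (h.fderiv_right (m := ∞) (by simp)).clm_comp contDiffAt_const
  exact h1.congr_of_eventuallyEq (h.eventually_differentiableAt.mono fun _ => fiberDeriv_eq)

theorem contDiffAt_baseDeriv {ℓ : E → E → ℝ} {z : E × E}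
    (h : ContDiffAt ℝ ∞ (fun z : E × E => ℓ z.1 z.2) z) :
    ContDiffAt ℝ ∞ (baseDeriv ℓ) z := by
  have h1 : ContDiffAt ℝ ∞ (fun z' => fderiv ℝ (fun z : E × E => ℓ z.1 z.2) z' ∘L
      ContinuousLinearMap.inl ℝ E E) z :=
    (h.fderiv_right (m := ∞) (by simp)).clm_comp contDiffAt_const
  exact h1.congr_of_eventuallyEq (h.eventually_differentiableAt.mono fun _ => baseDeriv_eq)

theorem _root_.ContDiffAt.deriv_of_two {c : ℝ → E} {t : ℝ} (h : ContDiffAt ℝ 2 c t) :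
    ContDiffAt ℝ 1 (deriv c) t := by
  have := (h.fderiv_right (m := 1) (by norm_num)).clm_apply
    (contDiffAt_const (c := (1 : ℝ)))
  simpa only [fderiv_apply_one_eq_deriv] using this

/-- The lift `(c, ċ)` of a `C²` curve is `C¹`. -/
theorem contDiffAt_lift {c : ℝ → E} {t : ℝ} (h : ContDiffAt ℝ 2 c t) :
    ContDiffAt ℝ 1 (fun s => (c s, deriv c s)) t :=
  (h.of_le (by norm_num)).prodMk h.deriv_of_two

/-- Naturality of the fibre derivative under a point transformation `j`. -/
theorem eventually_fiberDeriv_pullback {ℓ : E → E → ℝ} {ℓ' : E' → E' → ℝ} {j : E → E'}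
    {z : E × E} (hj : ContDiffAt ℝ ∞ j z.1)
    (hℓ' : ContDiffAt ℝ ∞ (fun z : E' × E' => ℓ' z.1 z.2) (j z.1, fderiv ℝ j z.1 z.2))
    (hcomp : ∀ᶠ z' : E × E in 𝓝 z, ℓ z'.1 z'.2 = ℓ' (j z'.1) (fderiv ℝ j z'.1 z'.2)) :
    ∀ᶠ z' : E × E in 𝓝 z, fiberDeriv ℓ z' =
      fiberDeriv ℓ' (j z'.1, fderiv ℝ j z'.1 z'.2) ∘L fderiv ℝ j z'.1 := by
  have hDj : ContinuousAt (fderiv ℝ j) z.1 := (hj.fderiv_right (m := ∞) (by simp)).continuousAt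
  have hcont : ContinuousAt (fun z' : E × E => (j z'.1, fderiv ℝ j z'.1 z'.2)) z :=
    (ContinuousAt.comp (f := Prod.fst) hj.continuousAt continuousAt_fst).prodMk
      ((ContinuousAt.comp (f := Prod.fst) hDj continuousAt_fst).clm_apply continuousAt_snd)
  filter_upwards [hcomp.eventually_nhds, hcont.eventually hℓ'.eventually_differentiableAt]
    with z' h1 h2
  have h3 : (fun w => ℓ z'.1 w) =ᶠ[𝓝 z'.2] fun w => ℓ' (j z'.1) (fderiv ℝ j z'.1 w) := by
    have : ContinuousAt (fun w : E => (z'.1, w)) z'.2 := by fun_prop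
    exact this.eventually h1
  have h4 : DifferentiableAt ℝ (ℓ' (j z'.1)) (fderiv ℝ j z'.1 z'.2) :=
    h2.comp (fderiv ℝ j z'.1 z'.2) (f := fun w => (j z'.1, w)) (by fun_prop)
  rw [fiberDeriv, h3.fderiv_eq]
  exact (h4.hasFDerivAt.comp z'.2 (fderiv ℝ j z'.1).hasFDerivAt).fderiv

/-- The position enters `ℓ' (j y) (fderiv ℝ j y w)` twice; the second occurrence yields the D²j term
that must later cancel. -/
theorem baseDeriv_pullback {ℓ : E → E → ℝ} {ℓ' : E' → E' → ℝ} {j : E → E'}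
    {z : E × E} (hj : ContDiffAt ℝ ∞ j z.1)
    (hℓ' : ContDiffAt ℝ ∞ (fun z : E' × E' => ℓ' z.1 z.2) (j z.1, fderiv ℝ j z.1 z.2))
    (hcomp : ∀ᶠ z' : E × E in 𝓝 z, ℓ z'.1 z'.2 = ℓ' (j z'.1) (fderiv ℝ j z'.1 z'.2)) (u : E) :
    baseDeriv ℓ z u = baseDeriv ℓ' (j z.1, fderiv ℝ j z.1 z.2) (fderiv ℝ j z.1 u) +
      fiberDeriv ℓ' (j z.1, fderiv ℝ j z.1 z.2) (fderiv ℝ (fderiv ℝ j) z.1 u z.2) := by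
  have h3 : (fun y => ℓ y z.2) =ᶠ[𝓝 z.1] fun y => ℓ' (j y) (fderiv ℝ j y z.2) := by
    have : ContinuousAt (fun y : E => (y, z.2)) z.1 := by fun_prop
    exact this.eventually hcomp
  have hd : DifferentiableAt ℝ (fun z : E' × E' => ℓ' z.1 z.2) (j z.1, fderiv ℝ j z.1 z.2) :=
    hℓ'.differentiableAt (by simp)
  have hDj : DifferentiableAt ℝ (fderiv ℝ j) z.1 :=
    (hj.fderiv_right (m := ∞) (by simp)).differentiableAt (by simp)
  have h5 : HasFDerivAt (fun y => (j y, fderiv ℝ j y z.2)) ((fderiv ℝ j z.1).prod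
      ((fderiv ℝ (fderiv ℝ j) z.1).flip z.2)) z.1 := by
    refine (hj.differentiableAt (by simp)).hasFDerivAt.prodMk ?_
    simpa using hDj.hasFDerivAt.clm_apply (hasFDerivAt_const z.2 z.1)
  have h6 := hd.hasFDerivAt.comp z.1 h5
  rw [baseDeriv, h3.fderiv_eq]
  rw [show (fun y => ℓ' (j y) (fderiv ℝ j y z.2)) =
    (fun z : E' × E' => ℓ' z.1 z.2) ∘ fun y => (j y, fderiv ℝ j y z.2) from rfl, h6.fderiv]
  simpa using fderiv_lagrangian_apply hd _ _

/-- Naturality of the Euler-Lagrange expression under a point transformation `j`. -/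
theorem hasDerivAt_fiberDeriv_pullback {ℓ : E → E → ℝ} {ℓ' : E' → E' → ℝ} {j : E → E'}
    {c : ℝ → E} {c' : ℝ → E'} {t : ℝ} (hc : ContDiffAt ℝ 2 c t) (hj : ContDiffAt ℝ ∞ j (c t))
    (hc' : c' =ᶠ[𝓝 t] j ∘ c)
    (hℓ' : ContDiffAt ℝ ∞ (fun z : E' × E' => ℓ' z.1 z.2) (c' t, deriv c' t))
    (hcomp : ∀ᶠ z : E × E in 𝓝 (c t, deriv c t), ℓ z.1 z.2 = ℓ' (j z.1) (fderiv ℝ j z.1 z.2))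
    {F : E' →L[ℝ] ℝ}
    (hF : HasDerivAt (fun s => fiberDeriv ℓ' (c' s, deriv c' s))
      (baseDeriv ℓ' (c' t, deriv c' t) + F) t) :
    HasDerivAt (fun s => fiberDeriv ℓ (c s, deriv c s))
      (baseDeriv ℓ (c t, deriv c t) + F ∘L fderiv ℝ j (c t)) t := by
  have hjev := hc.continuousAt.eventually hj.eventually_differentiableAt
  have hcev : ∀ᶠ s in 𝓝 t, DifferentiableAt ℝ c s :=
    (hc.eventually (by simp)).mono fun _ h => h.differentiableAt (by norm_num)
  have hlift : ∀ᶠ s in 𝓝 t, (c' s, deriv c' s) = (j (c s), fderiv ℝ j (c s) (deriv c s)) := by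
    filter_upwards [hc'.eventuallyEq_nhds, hjev, hcev] with s h1 h2 h3
    rw [h1.deriv_eq, h1.eq_of_nhds, fderiv_comp_deriv s h2 h3]
    rfl
  have ht := hlift.self_of_nhds
  rw [ht] at hℓ' hF
  have hfib := (contDiffAt_lift hc).continuousAt.eventually
    (eventually_fiberDeriv_pullback (z := (c t, deriv c t)) hj hℓ' hcomp)
  have hDj : HasDerivAt (fun s => fderiv ℝ j (c s)) (fderiv ℝ (fderiv ℝ j) (c t) (deriv c t)) t :=
    (((hj.fderiv_right (m := ∞) (by simp)).differentiableAt (by simp)).hasFDerivAt).comp_hasDerivAt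
      t (hc.differentiableAt (by norm_num)).hasDerivAt
  have hF2 := hF.clm_comp hDj
  have heq : (fun s => fiberDeriv ℓ (c s, deriv c s)) =ᶠ[𝓝 t]
      fun s => fiberDeriv ℓ' (c' s, deriv c' s) ∘L fderiv ℝ j (c s) := by
    filter_upwards [hlift, hfib] with s h1 h2
    rw [h2, h1]
  refine (hF2.congr_of_eventuallyEq heq).congr_deriv ?_
  ext u
  have h2 : minSmoothness ℝ 2 ≤ (∞ : WithTop ℕ∞) := by
    rw [minSmoothness_of_isRCLikeNormedField]
    exact ENat.LEInfty.out
  -- The product rule gives D²j(ċ, u), the chain rule for `baseDeriv` gives D²j(u, ċ); only the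
  -- pulled-back force survives.
  have hsymm := (hj.isSymmSndFDerivAt h2).eq u (deriv c t)
  have hb := baseDeriv_pullback (z := (c t, deriv c t)) hj hℓ' hcomp u
  simp only [add_apply, ContinuousLinearMap.comp_apply] at hb ⊢
  rw [hb, hsymm, ht]
  ring

/-- The Hamiltonian of a Lagrangian with nondegenerate fibre Hessian is differentiable, and its
partial derivatives are `w` and `-∂ℓ/∂y`. -/
theorem hasFDerivAt_legendreTransform [FiniteDimensional ℝ E] {ℓ : E → E → ℝ}
    {h : E → (E →L[ℝ] ℝ) → ℝ} {z₀ : E × E}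
    (hℓ : ContDiffAt ℝ ∞ (fun z : E × E => ℓ z.1 z.2) z₀)
    (hreg : ∀ u : E, (∀ w : E, fderiv ℝ (fun v => fderiv ℝ (ℓ z₀.1) v w) z₀.2 u = 0) → u = 0)
    (hh : ∀ᶠ z in 𝓝 z₀, h z.1 (fiberDeriv ℓ z) = fiberDeriv ℓ z z.2 - ℓ z.1 z.2) :
    HasFDerivAt (fun ζ : E × (E →L[ℝ] ℝ) => h ζ.1 ζ.2)
      ((ContinuousLinearMap.apply ℝ ℝ z₀.2) ∘L (ContinuousLinearMap.snd ℝ E (E →L[ℝ] ℝ)) -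
        baseDeriv ℓ z₀ ∘L ContinuousLinearMap.fst ℝ E (E →L[ℝ] ℝ)) (z₀.1, fiberDeriv ℓ z₀) := by
  have : CompleteSpace E := FiniteDimensional.complete ℝ E
  set Φ : E × E → E × (E →L[ℝ] ℝ) := fun z => (z.1, fiberDeriv ℓ z) with hΦ
  have hΦs : ContDiffAt ℝ ∞ Φ z₀ := contDiffAt_fst.prodMk (contDiffAt_fiberDeriv hℓ)
  have hfd : DifferentiableAt ℝ (fiberDeriv ℓ) z₀ :=
    (contDiffAt_fiberDeriv hℓ).differentiableAt (by simp)
  have hA : HasStrictFDerivAt Φ (fderiv ℝ Φ z₀) z₀ := hΦs.hasStrictFDerivAt (by simp)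
  have hA' : fderiv ℝ Φ z₀ = (ContinuousLinearMap.fst ℝ E E).prod (fderiv ℝ (fiberDeriv ℓ) z₀) :=
    (hasFDerivAt_fst.prodMk hfd.hasFDerivAt).fderiv
  -- The derivative of Φ is block triangular, with the identity and the fibre Hessian on the
  -- diagonal.
  have hinj : Function.Injective (fderiv ℝ Φ z₀) := by
    rw [injective_iff_map_eq_zero]
    rintro ⟨a, b⟩ hab
    rw [hA'] at hab
    simp only [ContinuousLinearMap.prod_apply, ContinuousLinearMap.coe_fst', Prod.mk_eq_zero]
      at hab
    obtain ⟨rfl, hb⟩ := hab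
    have : b = 0 := by
      refine hreg b fun w => ?_
      have h1 : HasFDerivAt (fun v => fiberDeriv ℓ (z₀.1, v))
          (fderiv ℝ (fiberDeriv ℓ) z₀ ∘L ContinuousLinearMap.inr ℝ E E) z₀.2 :=
        hfd.hasFDerivAt.comp (f := fun w => (z₀.1, w)) z₀.2 (hasFDerivAt_prodMk_right z₀.1 z₀.2)
      have h2 := h1.clm_apply (hasFDerivAt_const w z₀.2)
      have h3 : (fun v => fderiv ℝ (ℓ z₀.1) v w) = fun v => fiberDeriv ℓ (z₀.1, v) w := rfl
      rw [h3, h2.fderiv]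
      simp [hb]
    simp [this]
  have hrank : Module.finrank ℝ (E × E) = Module.finrank ℝ (E × (E →L[ℝ] ℝ)) := by
    have h1 : Module.finrank ℝ (E →L[ℝ] ℝ) = Module.finrank ℝ E := by
      rw [← (LinearMap.toContinuousLinearMap (𝕜 := ℝ) (E := E) (F' := ℝ)).finrank_eq]
      exact Subspace.dual_finrank_eq
    rw [Module.finrank_prod, Module.finrank_prod, h1]
  set A : (E × E) ≃L[ℝ] (E × (E →L[ℝ] ℝ)) :=
    (LinearMap.linearEquivOfInjective (fderiv ℝ Φ z₀).toLinearMap hinj hrank).toContinuousLinearEquiv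
    with hAdef
  have hAcoe : (A : (E × E) →L[ℝ] (E × (E →L[ℝ] ℝ))) = fderiv ℝ Φ z₀ := by
    exact ContinuousLinearMap.ext fun _ => rfl
  rw [← hAcoe] at hA
  set Ψ := hA.localInverse Φ A z₀ with hΨ
  have hΨ0 : Ψ (Φ z₀) = z₀ := hA.localInverse_apply_image
  have hΨd : HasFDerivAt Ψ (A.symm : (E × (E →L[ℝ] ℝ)) →L[ℝ] (E × E)) (Φ z₀) :=
    hA.to_localInverse.hasFDerivAt
  -- Near the image point every ζ is Φ of Ψ ζ, so the relation assumed on the image of Φ is an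
  -- explicit formula for h on a full neighbourhood.
  have hev : ∀ᶠ ζ in 𝓝 (Φ z₀), h ζ.1 ζ.2 = ζ.2 (Ψ ζ).2 - ℓ (Ψ ζ).1 (Ψ ζ).2 := by
    have h1 : ∀ᶠ ζ in 𝓝 (Φ z₀), h (Ψ ζ).1 (fiberDeriv ℓ (Ψ ζ)) =
        fiberDeriv ℓ (Ψ ζ) (Ψ ζ).2 - ℓ (Ψ ζ).1 (Ψ ζ).2 := by
      have := hΨd.continuousAt
      rw [ContinuousAt, hΨ0] at this
      exact this.eventually hh
    filter_upwards [h1, hA.eventually_right_inverse] with ζ h2 h3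
    have h4 : ζ = ((Ψ ζ).1, fiberDeriv ℓ (Ψ ζ)) := h3.symm
    have h5 : (Ψ ζ).1 = ζ.1 := (congrArg Prod.fst h4).symm
    have h6 : fiberDeriv ℓ (Ψ ζ) = ζ.2 := (congrArg Prod.snd h4).symm
    rw [← h6, ← h2, h5]
  have hfst : ∀ ζ, (A.symm ζ).1 = ζ.1 := by
    intro ζ
    have h1 : fderiv ℝ Φ z₀ (A.symm ζ) = ζ := by
      rw [← hAcoe]; exact A.apply_symm_apply ζ
    rw [hA'] at h1
    exact congrArg Prod.fst h1
  have hℓd : DifferentiableAt ℝ (fun z : E × E => ℓ z.1 z.2) z₀ := hℓ.differentiableAt (by simp)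
  have hsnd : HasFDerivAt (fun ζ => (Ψ ζ).2)
      (ContinuousLinearMap.snd ℝ E E ∘L (A.symm : (E × (E →L[ℝ] ℝ)) →L[ℝ] (E × E))) (Φ z₀) :=
    (ContinuousLinearMap.snd ℝ E E).hasFDerivAt.comp (Φ z₀) hΨd
  have hsnd' : HasFDerivAt (fun ζ : E × (E →L[ℝ] ℝ) => ζ.2) (ContinuousLinearMap.snd ℝ E (E →L[ℝ] ℝ))
    (Φ z₀) := hasFDerivAt_snd
  have hℓΨ : HasFDerivAt (fun ζ => ℓ (Ψ ζ).1 (Ψ ζ).2)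
      (fderiv ℝ (fun z : E × E => ℓ z.1 z.2) z₀ ∘L
        (A.symm : (E × (E →L[ℝ] ℝ)) →L[ℝ] (E × E))) (Φ z₀) := by
    have h1 := hℓd.hasFDerivAt
    rw [← hΨ0] at h1
    have h2 := h1.comp (Φ z₀) hΨd
    rwa [hΨ0] at h2
  refine (((hsnd'.clm_apply hsnd).sub hℓΨ).congr_of_eventuallyEq hev).congr_fderiv ?_
  -- The variation of the velocity is paired with the momentum in the first term and with ∂ℓ/∂w in
  -- the second, and these cancel. Of the inverse derivative only the first component is needed,
  -- which is `hfst`.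
  refine ContinuousLinearMap.ext fun ζ => ?_
  have h7 := fderiv_lagrangian_apply hℓd (A.symm ζ).1 (A.symm ζ).2
  rw [hfst] at h7
  have h8 : (ζ.1, (A.symm ζ).2) = A.symm ζ := Prod.ext (hfst ζ).symm rfl
  rw [h8] at h7
  simp only [sub_apply, add_apply,
    ContinuousLinearMap.comp_apply, ContinuousLinearMap.flip_apply, ContinuousLinearMap.coe_snd',
    ContinuousLinearMap.coe_fst', ContinuousLinearMap.apply_apply, ContinuousLinearEquiv.coe_coe,
    h7, hΨ0]
  simp only [hΦ]
  ring

end VectorSpace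


/-! ### Local expressions -/

section Charts

variable {E : Type*} [NormedAddCommGroup E] [NormedSpace ℝ E]
  {M : Type*} [TopologicalSpace M] [ChartedSpace E M]
  {E' : Type*} [NormedAddCommGroup E'] [NormedSpace ℝ E']
  {M' : Type*} [TopologicalSpace M'] [ChartedSpace E' M']
  {e : OpenPartialHomeomorph M E} {e' : OpenPartialHomeomorph M' E'}

/-- Every tangent space is definitionally the model space, so vectors over different base points can
be compared without a cast. -/
theorem tangentBundle_mk_eq {a b : M} (h : a = b) {v w : E} (hv : v = w) :
    (⟨a, v⟩ : TangentBundle 𝓘(ℝ, E) M) = ⟨b, w⟩ := by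
  subst h hv
  rfl

theorem tangentMap_congr {f g : M → M'} {p : TangentBundle 𝓘(ℝ, E) M} (h : f =ᶠ[𝓝 p.1] g) :
    tangentMap 𝓘(ℝ, E) 𝓘(ℝ, E') f p = tangentMap 𝓘(ℝ, E) 𝓘(ℝ, E') g p := by
  refine tangentBundle_mk_eq h.eq_of_nhds ?_
  have := h.mfderiv_eq (I := 𝓘(ℝ, E)) (I' := 𝓘(ℝ, E'))
  exact congrArg (fun A : E →L[ℝ] E' => A p.2) this

theorem velocityLift_congr {x y : ℝ → M} {t : ℝ} (h : x =ᶠ[𝓝 t] y) :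
    velocityLift (E := E) x t = velocityLift y t :=
  tangentMap_congr (E := ℝ) (M := ℝ) (p := (⟨t, (1 : ℝ)⟩ : TangentBundle 𝓘(ℝ, ℝ) ℝ)) h

theorem velocityLift_comp {x : ℝ → M} {t : ℝ} {f : M → M'}
    (hf : MDifferentiableAt 𝓘(ℝ, E) 𝓘(ℝ, E') f (x t))
    (hx : MDifferentiableAt 𝓘(ℝ, ℝ) 𝓘(ℝ, E) x t) :
    velocityLift (fun s => f (x s)) t =
      tangentMap 𝓘(ℝ, E) 𝓘(ℝ, E') f (velocityLift x t) :=
  tangentMap_comp_at (f := x) (g := f) (⟨t, (1 : ℝ)⟩ : TangentBundle 𝓘(ℝ, ℝ) ℝ) hf hx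

theorem tangentMap_model {f : E → E'} (p : TangentBundle 𝓘(ℝ, E) E) :
    tangentMap 𝓘(ℝ, E) 𝓘(ℝ, E') f p = ⟨f p.1, fderiv ℝ f p.1 p.2⟩ := by
  rw [tangentMap, mfderiv_eq_fderiv]
  rfl

theorem velocityLift_model (c : ℝ → E) (t : ℝ) :
    velocityLift (E := E) c t = ⟨c t, deriv c t⟩ := by
  rw [velocityLift, mfderiv_eq_fderiv]
  exact tangentBundle_mk_eq rfl (fderiv_apply_one_eq_deriv (𝕜 := ℝ) (f := c) (x := t))

theorem localLagrangian_eq (L : TangentBundle 𝓘(ℝ, E) M → ℝ) (e : OpenPartialHomeomorph M E)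
    (y w : E) : localLagrangian L e y w = L (tangentMap 𝓘(ℝ, E) 𝓘(ℝ, E) e.symm ⟨y, w⟩) := rfl

theorem mdifferentiable_of_mem_maximalAtlas (he : e ∈ IsManifold.maximalAtlas 𝓘(ℝ, E) ∞ M) :
    e.MDifferentiable 𝓘(ℝ, E) 𝓘(ℝ, E) :=
  ⟨(contMDiffOn_of_mem_maximalAtlas he).mdifferentiableOn (by simp),
    (contMDiffOn_symm_of_mem_maximalAtlas he).mdifferentiableOn (by simp)⟩

theorem contDiffAt_chart_comp {F : Type*} [NormedAddCommGroup F] [NormedSpace ℝ F] {x : F → M}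
    {z : F} {n : WithTop ℕ∞} (hn : n ≤ ∞) (hx : ContMDiffAt 𝓘(ℝ, F) 𝓘(ℝ, E) n x z)
    (he : e ∈ IsManifold.maximalAtlas 𝓘(ℝ, E) ∞ M) (hz : x z ∈ e.source) :
    ContDiffAt ℝ n (fun s => e (x s)) z :=
  (((contMDiffAt_of_mem_maximalAtlas he hz).of_le hn).comp z hx).contDiffAt

theorem contDiffAt_writtenInCharts {f : M → M'} {q : M}
    (hf : ContMDiffAt 𝓘(ℝ, E) 𝓘(ℝ, E') ∞ f q)
    (he : e ∈ IsManifold.maximalAtlas 𝓘(ℝ, E) ∞ M) (hq : q ∈ e.source)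
    (he' : e' ∈ IsManifold.maximalAtlas 𝓘(ℝ, E') ∞ M') (hq' : f q ∈ e'.source) :
    ContDiffAt ℝ ∞ (fun y => e' (f (e.symm y))) (e q) := by
  have h1 : ContMDiffAt 𝓘(ℝ, E) 𝓘(ℝ, E) ∞ e.symm (e q) :=
    contMDiffAt_symm_of_mem_maximalAtlas he (e.map_source hq)
  refine contDiffAt_chart_comp (x := fun y => f (e.symm y)) le_rfl ?_ he' ?_
  · refine ContMDiffAt.comp (e q) (g := f) ?_ h1
    rwa [e.left_inv hq]
  · rwa [e.left_inv hq]

theorem contDiffAt_fun_comp_symm {f : M → ℝ} (hf : ContMDiff 𝓘(ℝ, E) 𝓘(ℝ, ℝ) ∞ f)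
    (he : e ∈ IsManifold.maximalAtlas 𝓘(ℝ, E) ∞ M) {y : E} (hy : y ∈ e.target) :
    ContDiffAt ℝ ∞ (fun y => f (e.symm y)) y :=
  ((hf.contMDiffAt).comp y (contMDiffAt_symm_of_mem_maximalAtlas he hy)).contDiffAt

theorem dLdv_congr (L : TangentBundle 𝓘(ℝ, E) M → ℝ) (e : OpenPartialHomeomorph M E)
    {x y : ℝ → M} {t : ℝ} (h : x =ᶠ[𝓝 t] y) : dLdv L e x =ᶠ[𝓝 t] dLdv L e y := by
  filter_upwards [h.eventuallyEq_nhds] with s hs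
  have h1 : (fun s => e (x s)) =ᶠ[𝓝 s] fun s => e (y s) := hs.fun_comp e
  rw [dLdv, dLdv, h1.deriv_eq, hs.eq_of_nhds]

theorem dLdx_congr (L : TangentBundle 𝓘(ℝ, E) M → ℝ) (e : OpenPartialHomeomorph M E)
    {x y : ℝ → M} {t : ℝ} (h : x =ᶠ[𝓝 t] y) : dLdx L e x t = dLdx L e y t := by
  have h1 : (fun s => e (x s)) =ᶠ[𝓝 t] fun s => e (y s) := h.fun_comp e
  rw [dLdx, dLdx, h1.deriv_eq, h.eq_of_nhds]

/-- The inverse chart is smooth only on its target, so smoothness is taken from `tangentMapWithin`,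
which agrees with `tangentMap` on that open set. -/
theorem contMDiffOn_tangentMap_symm [IsManifold 𝓘(ℝ, E) ∞ M]
    (he : e ∈ IsManifold.maximalAtlas 𝓘(ℝ, E) ∞ M) :
    ContMDiffOn 𝓘(ℝ, E × E) 𝓘(ℝ, E).tangent ∞
      (fun z : E × E => tangentMap 𝓘(ℝ, E) 𝓘(ℝ, E) e.symm ⟨z.1, z.2⟩) {z | z.1 ∈ e.target} := by
  have h1 : ContMDiffOn 𝓘(ℝ, E).tangent 𝓘(ℝ, E).tangent ∞
      (tangentMapWithin 𝓘(ℝ, E) 𝓘(ℝ, E) e.symm e.target)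
      ((Bundle.TotalSpace.proj : TangentBundle 𝓘(ℝ, E) E → E) ⁻¹' e.target) :=
    (contMDiffOn_symm_of_mem_maximalAtlas he).contMDiffOn_tangentMapWithin (by simp)
      e.open_target.uniqueMDiffOn
  have h2 : ContMDiff (𝓘(ℝ, E).tangent) (𝓘(ℝ, E).tangent) ∞
      ((tangentBundleModelSpaceHomeomorph 𝓘(ℝ, E)).symm) :=
    contMDiff_tangentBundleModelSpaceHomeomorph_symm
  have h3 : ContMDiffOn (𝓘(ℝ, E).tangent) 𝓘(ℝ, E).tangent ∞
      (fun z : ModelProd E E => tangentMapWithin 𝓘(ℝ, E) 𝓘(ℝ, E) e.symm e.target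
        ((tangentBundleModelSpaceHomeomorph 𝓘(ℝ, E)).symm z))
      {z : ModelProd E E | z.1 ∈ e.target} :=
    h1.comp (h2.contMDiffOn (s := {z : ModelProd E E | z.1 ∈ e.target})) (fun z hz => hz)
  have h4 : ContMDiffOn 𝓘(ℝ, E × E) 𝓘(ℝ, E).tangent ∞
      (fun z : E × E => tangentMapWithin 𝓘(ℝ, E) 𝓘(ℝ, E) e.symm e.target ⟨z.1, z.2⟩)
      {z : E × E | z.1 ∈ e.target} := by
    rw [modelWithCornersSelf_prod]
    exact h3
  refine h4.congr fun z hz => ?_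
  exact (tangentMapWithin_eq_tangentMap (p := ⟨z.1, z.2⟩)
    (e.open_target.uniqueMDiffWithinAt hz)
    ((mdifferentiable_of_mem_maximalAtlas he).symm.mdifferentiableAt hz)).symm

theorem contDiffAt_localLagrangian [IsManifold 𝓘(ℝ, E) ∞ M]
    {L : TangentBundle 𝓘(ℝ, E) M → ℝ}
    (hL : ContMDiff 𝓘(ℝ, E).tangent 𝓘(ℝ, ℝ) ∞ L)
    (he : e ∈ IsManifold.maximalAtlas 𝓘(ℝ, E) ∞ M) {z : E × E} (hz : z.1 ∈ e.target) :
    ContDiffAt ℝ ∞ (fun z : E × E => localLagrangian L e z.1 z.2) z :=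
  (hL.comp_contMDiffOn (contMDiffOn_tangentMap_symm he)).contDiffOn.contDiffAt
    ((e.open_target.preimage continuous_fst).mem_nhds hz)

theorem tangentMap_symm_chart {x : ℝ → M} {t : ℝ} (hx : MDifferentiableAt 𝓘(ℝ, ℝ) 𝓘(ℝ, E) x t)
    (he : e ∈ IsManifold.maximalAtlas 𝓘(ℝ, E) ∞ M) (ht : x t ∈ e.source) :
    tangentMap 𝓘(ℝ, E) 𝓘(ℝ, E) e.symm ⟨e (x t), deriv (fun s => e (x s)) t⟩ =
      velocityLift x t := by
  have hd := mdifferentiable_of_mem_maximalAtlas he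
  have hc : MDifferentiableAt 𝓘(ℝ, ℝ) 𝓘(ℝ, E) (fun s => e (x s)) t :=
    (hd.mdifferentiableAt ht).comp t hx
  have h1 := velocityLift_comp (f := e.symm) (x := fun s => e (x s)) (t := t)
    (hd.symm.mdifferentiableAt (e.map_source ht)) hc
  rw [velocityLift_model] at h1
  rw [← h1]
  refine velocityLift_congr ?_
  filter_upwards [hx.continuousAt.preimage_mem_nhds (e.open_source.mem_nhds ht)] with s hs
  exact e.left_inv hs

/-- A Lagrangian along the velocity of a curve, in a chart. -/
theorem lagrangian_velocityLift (L : TangentBundle 𝓘(ℝ, E) M → ℝ) {x : ℝ → M} {t : ℝ}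
    (hx : MDifferentiableAt 𝓘(ℝ, ℝ) 𝓘(ℝ, E) x t)
    (he : e ∈ IsManifold.maximalAtlas 𝓘(ℝ, E) ∞ M) (ht : x t ∈ e.source) :
    L (velocityLift x t) = localLagrangian L e (e (x t)) (deriv (fun s => e (x s)) t) :=
  congrArg L (tangentMap_symm_chart hx he ht).symm

/-- Both sides are L' evaluated on the tangent map of f ∘ e⁻¹: near the point f ∘ e⁻¹ stays in the
domain of e', so inserting e'⁻¹ ∘ e' changes nothing. This is the hypothesis ℓ = ℓ' ∘ Tj of the
naturality statements. -/
theorem eventually_localLagrangian_eq {L : TangentBundle 𝓘(ℝ, E) M → ℝ}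
    {L' : TangentBundle 𝓘(ℝ, E') M' → ℝ} {f : M → M'} (hf : ContMDiff 𝓘(ℝ, E) 𝓘(ℝ, E') ∞ f)
    (hLL' : ∀ v, L' (tangentMap 𝓘(ℝ, E) 𝓘(ℝ, E') f v) = L v) {q : M}
    (he : e ∈ IsManifold.maximalAtlas 𝓘(ℝ, E) ∞ M) (hq : q ∈ e.source)
    (he' : e' ∈ IsManifold.maximalAtlas 𝓘(ℝ, E') ∞ M') (hq' : f q ∈ e'.source) (w : E) :
    ∀ᶠ z : E × E in 𝓝 (e q, w), localLagrangian L e z.1 z.2 =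
      localLagrangian L' e' (e' (f (e.symm z.1)))
        (fderiv ℝ (fun y => e' (f (e.symm y))) z.1 z.2) := by
  have hcont : ContinuousAt (fun y => f (e.symm y)) (e q) :=
    hf.continuous.continuousAt.comp (e.continuousAt_symm (e.map_source hq))
  have h1 : ∀ᶠ y in 𝓝 (e q), y ∈ e.target := e.open_target.mem_nhds (e.map_source hq)
  have h2 : ∀ᶠ y in 𝓝 (e q), f (e.symm y) ∈ e'.source :=
    hcont.preimage_mem_nhds (e'.open_source.mem_nhds (by simpa [e.left_inv hq] using hq'))
  have hfst : ContinuousAt (Prod.fst : E × E → E) (e q, w) := continuousAt_fst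
  filter_upwards [hfst.eventually h1, hfst.eventually h2.eventually_nhds] with z hz1 hz2
  have hd := mdifferentiable_of_mem_maximalAtlas he
  have hd' := mdifferentiable_of_mem_maximalAtlas he'
  have hz2' := hz2.self_of_nhds
  have hfe : MDifferentiableAt 𝓘(ℝ, E) 𝓘(ℝ, E') (fun y => f (e.symm y)) z.1 :=
    ((hf.mdifferentiable (by simp)) _).comp z.1 (hd.symm.mdifferentiableAt hz1)
  rw [localLagrangian_eq, ← hLL', localLagrangian_eq,
    ← tangentMap_comp_at (p := (⟨z.1, z.2⟩ : TangentBundle 𝓘(ℝ, E) E)) (g := f) (f := e.symm)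
      (hf.mdifferentiable (by simp) _) (hd.symm.mdifferentiableAt hz1)]
  have h3 := tangentMap_comp_at (I := 𝓘(ℝ, E)) (I' := 𝓘(ℝ, E')) (I'' := 𝓘(ℝ, E'))
    (p := (⟨z.1, z.2⟩ : TangentBundle 𝓘(ℝ, E) E)) (g := e'.symm)
    (f := fun y => e' (f (e.symm y))) (hd'.symm.mdifferentiableAt (e'.map_source hz2'))
      ((hd'.mdifferentiableAt hz2').comp z.1 hfe)
  rw [tangentMap_model] at h3
  rw [← h3]
  refine congrArg L' (tangentMap_congr ?_)
  filter_upwards [hz2] with y hy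
  exact (e'.left_inv hy).symm

/-- Naturality of the Euler-Lagrange equations with a force `F`, under a smooth map `f`. -/
theorem hasDerivAt_dLdv_pullback [IsManifold 𝓘(ℝ, E') ∞ M']
    {L : TangentBundle 𝓘(ℝ, E) M → ℝ}
    {L' : TangentBundle 𝓘(ℝ, E') M' → ℝ} (hL' : ContMDiff 𝓘(ℝ, E').tangent 𝓘(ℝ, ℝ) ∞ L')
    {f : M → M'} (hf : ContMDiff 𝓘(ℝ, E) 𝓘(ℝ, E') ∞ f)
    (hLL' : ∀ v, L' (tangentMap 𝓘(ℝ, E) 𝓘(ℝ, E') f v) = L v) {x : ℝ → M} {t : ℝ}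
    (hx : ContMDiffAt 𝓘(ℝ, ℝ) 𝓘(ℝ, E) 2 x t)
    (he : e ∈ IsManifold.maximalAtlas 𝓘(ℝ, E) ∞ M) (hq : x t ∈ e.source)
    (he' : e' ∈ IsManifold.maximalAtlas 𝓘(ℝ, E') ∞ M') (hq' : f (x t) ∈ e'.source)
    {F : E' →L[ℝ] ℝ}
    (hF : HasDerivAt (dLdv L' e' (fun s => f (x s))) (dLdx L' e' (fun s => f (x s)) t + F) t) :
    HasDerivAt (dLdv L e x)
      (dLdx L e x t + F ∘L fderiv ℝ (fun y => e' (f (e.symm y))) (e (x t))) t := by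
  refine hasDerivAt_fiberDeriv_pullback (ℓ := localLagrangian L e) (ℓ' := localLagrangian L' e')
    (c := fun s => e (x s)) (c' := fun s => e' (f (x s)))
    (contDiffAt_chart_comp ENat.LEInfty.out hx he hq)
    (contDiffAt_writtenInCharts hf.contMDiffAt he hq he' hq') ?_
    (contDiffAt_localLagrangian hL' he' (e'.map_source hq'))
    (eventually_localLagrangian_eq hf hLL' he hq he' hq' _) hF
  filter_upwards [hx.continuousAt.preimage_mem_nhds (e.open_source.mem_nhds hq)] with s hs
  simp [e.left_inv hs]

theorem contDiffAt_dLdv [IsManifold 𝓘(ℝ, E) ∞ M]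
    {L : TangentBundle 𝓘(ℝ, E) M → ℝ}
    (hL : ContMDiff 𝓘(ℝ, E).tangent 𝓘(ℝ, ℝ) ∞ L) {x : ℝ → M} {t : ℝ}
    (hx : ContMDiffAt 𝓘(ℝ, ℝ) 𝓘(ℝ, E) 2 x t)
    (he : e ∈ IsManifold.maximalAtlas 𝓘(ℝ, E) ∞ M) (ht : x t ∈ e.source) :
    ContDiffAt ℝ 1 (dLdv L e x) t :=
  ContDiffAt.comp t (g := fiberDeriv (localLagrangian L e))
    (f := fun s => (e (x s), deriv (fun s => e (x s)) s))
    ((contDiffAt_fiberDeriv (contDiffAt_localLagrangian hL he (e.map_source ht))).of_le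
      (mod_cast le_top))
    (contDiffAt_lift (contDiffAt_chart_comp ENat.LEInfty.out hx he ht))

theorem continuousAt_dLdx [IsManifold 𝓘(ℝ, E) ∞ M]
    {L : TangentBundle 𝓘(ℝ, E) M → ℝ}
    (hL : ContMDiff 𝓘(ℝ, E).tangent 𝓘(ℝ, ℝ) ∞ L) {x : ℝ → M} {t : ℝ}
    (hx : ContMDiffAt 𝓘(ℝ, ℝ) 𝓘(ℝ, E) 2 x t)
    (he : e ∈ IsManifold.maximalAtlas 𝓘(ℝ, E) ∞ M) (ht : x t ∈ e.source) :
    ContinuousAt (dLdx L e x) t :=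
  ContinuousAt.comp (g := baseDeriv (localLagrangian L e))
    (f := fun s => (e (x s), deriv (fun s => e (x s)) s))
    (contDiffAt_baseDeriv (contDiffAt_localLagrangian hL he (e.map_source ht))).continuousAt
    (contDiffAt_lift (contDiffAt_chart_comp ENat.LEInfty.out hx he ht)).continuousAt

/-- Naturality of the differential of a function. -/
theorem dFun_comp {g : M' → ℝ} (hg : ContMDiff 𝓘(ℝ, E') 𝓘(ℝ, ℝ) ∞ g)
    {f : M → M'} (hf : ContMDiff 𝓘(ℝ, E) 𝓘(ℝ, E') ∞ f) {q : M}
    (he : e ∈ IsManifold.maximalAtlas 𝓘(ℝ, E) ∞ M) (hq : q ∈ e.source)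
    (he' : e' ∈ IsManifold.maximalAtlas 𝓘(ℝ, E') ∞ M') (hq' : f q ∈ e'.source) :
    dFun g e' (f q) ∘L fderiv ℝ (fun y => e' (f (e.symm y))) (e q) =
      dFun (fun q => g (f q)) e q := by
  have hcont : ContinuousAt (fun y => f (e.symm y)) (e q) :=
    hf.continuous.continuousAt.comp (e.continuousAt_symm (e.map_source hq))
  have h2 : ∀ᶠ y in 𝓝 (e q), f (e.symm y) ∈ e'.source :=
    hcont.preimage_mem_nhds (e'.open_source.mem_nhds (by simpa [e.left_inv hq] using hq'))
  have h3 : (fun y => g (f (e.symm y))) =ᶠ[𝓝 (e q)]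
      (fun y => g (e'.symm y)) ∘ fun y => e' (f (e.symm y)) := by
    filter_upwards [h2] with y hy
    simp [e'.left_inv hy]
  have h4 : DifferentiableAt ℝ (fun y => g (e'.symm y)) (e' (f (e.symm (e q)))) := by
    rw [e.left_inv hq]
    exact (contDiffAt_fun_comp_symm hg he' (e'.map_source hq')).differentiableAt (by simp)
  rw [dFun, dFun, h3.fderiv_eq, fderiv_comp (e q) h4
    ((contDiffAt_writtenInCharts hf.contMDiffAt he hq he' hq').differentiableAt (by simp)),
    e.left_inv hq]

theorem dFun_eq_differential {g : M → ℝ} (hg : ContMDiff 𝓘(ℝ, E) 𝓘(ℝ, ℝ) ∞ g) {q : M}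
    (he : e ∈ IsManifold.maximalAtlas 𝓘(ℝ, E) ∞ M) (hq : q ∈ e.source) :
    dFun g e q ∘L mfderiv 𝓘(ℝ, E) 𝓘(ℝ, E) e q = differential E g q := by
  have hd := mdifferentiable_of_mem_maximalAtlas he
  have h3 : g =ᶠ[𝓝 q] (fun y => g (e.symm y)) ∘ e := by
    filter_upwards [e.open_source.mem_nhds hq] with y hy
    simp [e.left_inv hy]
  have h4 : MDifferentiableAt 𝓘(ℝ, E) 𝓘(ℝ, ℝ) (fun y => g (e.symm y)) (e q) :=
    ((contDiffAt_fun_comp_symm hg he (e.map_source hq)).differentiableAt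
      (by simp)).mdifferentiableAt
  rw [differential, h3.mfderiv_eq, mfderiv_comp q h4 (hd.mdifferentiableAt hq), dFun,
    ← mfderiv_eq_fderiv]
  rfl

/-- The intrinsic differentials are the chart differentials composed with one linear map, so a
relation among the latter is a relation among the former. -/
theorem linearIndependent_dFun {k : ℕ} {φ : Fin k → M → ℝ}
    (hφ : ∀ α, ContMDiff 𝓘(ℝ, E) 𝓘(ℝ, ℝ) ∞ (φ α)) {q : M}
    (h : LinearIndependent ℝ (fun α => differential E (φ α) q))
    (he : e ∈ IsManifold.maximalAtlas 𝓘(ℝ, E) ∞ M) (hq : q ∈ e.source) :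
    LinearIndependent ℝ (fun α => dFun (φ α) e q) := by
  set B : E →L[ℝ] E := mfderiv 𝓘(ℝ, E) 𝓘(ℝ, E) e q with hB
  -- The differentials are replaced by forms on the plain model space, to keep `TangentSpace` types
  -- out of the algebra.
  obtain ⟨v, hv, h'⟩ : ∃ v : Fin k → E →L[ℝ] ℝ, (∀ α, dFun (φ α) e q ∘L B = v α) ∧
      LinearIndependent ℝ v :=
    ⟨fun α => differential E (φ α) q, fun α => dFun_eq_differential (hφ α) he hq, h⟩
  rw [Fintype.linearIndependent_iff] at h' ⊢
  intro g hg
  refine h' g ?_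
  simp_rw [← hv, ← ContinuousLinearMap.smul_comp, ← ContinuousLinearMap.finsetSum_comp, hg,
    ContinuousLinearMap.zero_comp]

end Charts


/-! ### The Legendre transformation -/

section Legendre

variable {E : Type*} [NormedAddCommGroup E] [NormedSpace ℝ E]
  {M : Type*} [TopologicalSpace M] [ChartedSpace E M]
  {e : OpenPartialHomeomorph M E}

/-- The velocity coordinates of a tangent vector, in the chart `e`. -/
def velocityCoord (e : OpenPartialHomeomorph M E) (v : TangentBundle 𝓘(ℝ, E) M) : E :=
  mfderiv 𝓘(ℝ, E) 𝓘(ℝ, E) e v.1 v.2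

theorem lagrangian_fiber_eq (L : TangentBundle 𝓘(ℝ, E) M → ℝ)
    (he : e ∈ IsManifold.maximalAtlas 𝓘(ℝ, E) ∞ M) {q : M} (hq : q ∈ e.source) (w : E) :
    L ⟨q, w⟩ = localLagrangian L e (e q) (velocityCoord e ⟨q, w⟩) := by
  have hd := mdifferentiable_of_mem_maximalAtlas he
  have h1 := congrArg (fun A : E →L[ℝ] E => A w) (hd.symm_comp_deriv hq)
  exact congrArg L (tangentBundle_mk_eq (e.left_inv hq).symm h1.symm)

theorem velocityCoord_tangentMap_symm (he : e ∈ IsManifold.maximalAtlas 𝓘(ℝ, E) ∞ M) {z : E × E}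
    (hz : z.1 ∈ e.target) :
    velocityCoord e (tangentMap 𝓘(ℝ, E) 𝓘(ℝ, E) e.symm ⟨z.1, z.2⟩) = z.2 :=
  congrArg (fun A : E →L[ℝ] E => A z.2)
    ((mdifferentiable_of_mem_maximalAtlas he).comp_symm_deriv hz)

theorem tangentMap_symm_velocityCoord (he : e ∈ IsManifold.maximalAtlas 𝓘(ℝ, E) ∞ M)
    {v : TangentBundle 𝓘(ℝ, E) M} (hv : v.1 ∈ e.source) :
    tangentMap 𝓘(ℝ, E) 𝓘(ℝ, E) e.symm ⟨e v.1, (velocityCoord e v : E)⟩ = v :=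
  tangentBundle_mk_eq (e.left_inv hv) (congrArg (fun A : E →L[ℝ] E => A v.2)
    ((mdifferentiable_of_mem_maximalAtlas he).symm_comp_deriv hv))

theorem velocityCoord_velocityLift {x : ℝ → M} {t : ℝ}
    (hx : MDifferentiableAt 𝓘(ℝ, ℝ) 𝓘(ℝ, E) x t)
    (he : e ∈ IsManifold.maximalAtlas 𝓘(ℝ, E) ∞ M) (ht : x t ∈ e.source) :
    velocityCoord e (velocityLift x t) = deriv (fun s => e (x s)) t := by
  rw [← tangentMap_symm_chart hx he ht]
  exact velocityCoord_tangentMap_symm (z := (_, _)) he (e.map_source ht)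

/-- Free dynamics is constrained dynamics with an empty family of constraints, so a single Legendre
argument serves both. -/
theorem isHamilton_iff_zero (H : CotangentBundle E M → ℝ) (I : Set ℝ)
    (P : ℝ → CotangentBundle E M) (φ : Fin 0 → M → ℝ) (Λ : ℝ → Fin 0 → ℝ) :
    IsHamilton H I P ↔ IsConstrainedHamilton H φ I P Λ := by
  simp [IsHamilton, IsConstrainedHamilton]

theorem isEulerLagrange_iff_zero (L : TangentBundle 𝓘(ℝ, E) M → ℝ) (I : Set ℝ)
    (x : ℝ → M) (φ : Fin 0 → M → ℝ) (Λ : ℝ → Fin 0 → ℝ) :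
    IsEulerLagrange L I x ↔ IsConstrainedEulerLagrange L φ I x Λ := by
  simp [IsEulerLagrange, IsConstrainedEulerLagrange]

variable [IsManifold 𝓘(ℝ, E) ∞ M]

theorem hasFDerivAt_lagrangian_fiber {L : TangentBundle 𝓘(ℝ, E) M → ℝ}
    (hL : ContMDiff 𝓘(ℝ, E).tangent 𝓘(ℝ, ℝ) ∞ L)
    (he : e ∈ IsManifold.maximalAtlas 𝓘(ℝ, E) ∞ M) {q : M} (hq : q ∈ e.source) (w : E) :
    HasFDerivAt (fun w : E => L ⟨q, w⟩)
      (fiberDeriv (localLagrangian L e) (e q, velocityCoord e ⟨q, w⟩) ∘L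
        (mfderiv 𝓘(ℝ, E) 𝓘(ℝ, E) e q : E →L[ℝ] E)) w := by
  have h1 : DifferentiableAt ℝ (localLagrangian L e (e q)) (velocityCoord e ⟨q, w⟩) :=
    ((contDiffAt_localLagrangian hL he (z := (e q, velocityCoord e ⟨q, w⟩))
      (e.map_source hq)).differentiableAt (by simp)).comp (velocityCoord e ⟨q, w⟩)
      (f := fun w => (e q, w)) (by fun_prop)
  have h2 : HasFDerivAt (fun w : E => velocityCoord e ⟨q, w⟩)
      (mfderiv 𝓘(ℝ, E) 𝓘(ℝ, E) e q : E →L[ℝ] E) w :=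
    (mfderiv 𝓘(ℝ, E) 𝓘(ℝ, E) e q : E →L[ℝ] E).hasFDerivAt
  exact (h1.hasFDerivAt.comp w h2).congr_of_eventuallyEq
    (Filter.Eventually.of_forall fun w => lagrangian_fiber_eq L he hq w)

theorem legendreMap_snd {L : TangentBundle 𝓘(ℝ, E) M → ℝ}
    (hL : ContMDiff 𝓘(ℝ, E).tangent 𝓘(ℝ, ℝ) ∞ L)
    (he : e ∈ IsManifold.maximalAtlas 𝓘(ℝ, E) ∞ M) {v : TangentBundle 𝓘(ℝ, E) M}
    (hv : v.1 ∈ e.source) :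
    (legendreMap L v).2 = fiberDeriv (localLagrangian L e) (e v.1, velocityCoord e v) ∘L
        (mfderiv 𝓘(ℝ, E) 𝓘(ℝ, E) e v.1 : E →L[ℝ] E) :=
  (hasFDerivAt_lagrangian_fiber hL he hv v.2).fderiv

theorem momentumCoord_legendreMap {L : TangentBundle 𝓘(ℝ, E) M → ℝ}
    (hL : ContMDiff 𝓘(ℝ, E).tangent 𝓘(ℝ, ℝ) ∞ L)
    (he : e ∈ IsManifold.maximalAtlas 𝓘(ℝ, E) ∞ M) {v : TangentBundle 𝓘(ℝ, E) M}
    (hv : v.1 ∈ e.source) :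
    momentumCoord e (legendreMap L v) =
      fiberDeriv (localLagrangian L e) (e v.1, velocityCoord e v) := by
  have hd := mdifferentiable_of_mem_maximalAtlas he
  -- `ContinuousLinearMap.inverse` is determined only once a two-sided inverse is exhibited; here it
  -- is the derivative of the inverse chart.
  obtain ⟨A, B, hB, hAB, hBA⟩ : ∃ A B : E →L[ℝ] E, B = mfderiv 𝓘(ℝ, E) 𝓘(ℝ, E) e v.1 ∧
      A ∘L B = ContinuousLinearMap.id ℝ E ∧ B ∘L A = ContinuousLinearMap.id ℝ E := by
    refine ⟨mfderiv 𝓘(ℝ, E) 𝓘(ℝ, E) e.symm (e v.1), mfderiv 𝓘(ℝ, E) 𝓘(ℝ, E) e v.1, rfl,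
      hd.symm_comp_deriv hv, ?_⟩
    have := hd.comp_symm_deriv (e.map_source hv)
    rwa [e.left_inv hv] at this
  have h1 : momentumCoord e (legendreMap L v) =
      ((legendreMap L v).2 : E →L[ℝ] ℝ) ∘L B.inverse := by rw [hB]; rfl
  have h2 : ((legendreMap L v).2 : E →L[ℝ] ℝ) =
      fiberDeriv (localLagrangian L e) (e v.1, velocityCoord e v) ∘L B := by
    rw [hB]
    exact legendreMap_snd hL he hv
  have h3 : momentumCoord e (legendreMap L v) =
      (fiberDeriv (localLagrangian L e) (e v.1, velocityCoord e v) ∘L B) ∘L A := by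
    rw [h1, h2, ContinuousLinearMap.inverse_eq hBA hAB]
    rfl
  rw [h3, ContinuousLinearMap.comp_assoc, hBA, ContinuousLinearMap.comp_id]

theorem localHamiltonian_fiberDeriv {L : TangentBundle 𝓘(ℝ, E) M → ℝ}
    (hL : ContMDiff 𝓘(ℝ, E).tangent 𝓘(ℝ, ℝ) ∞ L) (H : CotangentBundle E M → ℝ)
    (he : e ∈ IsManifold.maximalAtlas 𝓘(ℝ, E) ∞ M) {z : E × E} (hz : z.1 ∈ e.target) :
    localHamiltonian H e z.1 (fiberDeriv (localLagrangian L e) z) =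
      H (legendreMap L (tangentMap 𝓘(ℝ, E) 𝓘(ℝ, E) e.symm ⟨z.1, z.2⟩)) := by
  set v := tangentMap 𝓘(ℝ, E) 𝓘(ℝ, E) e.symm (⟨z.1, z.2⟩ : TangentBundle 𝓘(ℝ, E) E) with hv
  have hvs : v.1 ∈ e.source := e.map_target hz
  have h1 := legendreMap_snd hL he hvs
  rw [hv, velocityCoord_tangentMap_symm he hz] at h1
  have h2 : e v.1 = z.1 := e.right_inv hz
  have h3 : legendreMap L v = ⟨v.1, (legendreMap L v).2⟩ := rfl
  rw [h3, hv, h1, ← hv, h2]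
  rfl

theorem energy_eq_local {L : TangentBundle 𝓘(ℝ, E) M → ℝ}
    (hL : ContMDiff 𝓘(ℝ, E).tangent 𝓘(ℝ, ℝ) ∞ L)
    (he : e ∈ IsManifold.maximalAtlas 𝓘(ℝ, E) ∞ M) {z : E × E} (hz : z.1 ∈ e.target) :
    energy L (tangentMap 𝓘(ℝ, E) 𝓘(ℝ, E) e.symm ⟨z.1, z.2⟩) =
      fiberDeriv (localLagrangian L e) z z.2 - localLagrangian L e z.1 z.2 := by
  set v := tangentMap 𝓘(ℝ, E) 𝓘(ℝ, E) e.symm (⟨z.1, z.2⟩ : TangentBundle 𝓘(ℝ, E) E) with hv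
  have hvs : v.1 ∈ e.source := e.map_target hz
  have h1 := congrArg (fun A : E →L[ℝ] ℝ => A v.2) (legendreMap_snd hL he hvs)
  have h2 : e v.1 = z.1 := e.right_inv hz
  have h3 : velocityCoord e v = z.2 := velocityCoord_tangentMap_symm he hz
  rw [h2, h3] at h1
  refine congrArg₂ (· - ·) (h1.trans ?_) rfl
  exact congrArg (fiberDeriv (localLagrangian L e) z) h3

/-- In a fibre the chart acts as an invertible linear substitution B, under which a null vector of
the local Hessian comes from a null vector of the intrinsic one. -/
theorem localLagrangian_nondegenerate {L : TangentBundle 𝓘(ℝ, E) M → ℝ}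
    (hL : ContMDiff 𝓘(ℝ, E).tangent 𝓘(ℝ, ℝ) ∞ L) {U : Set (TangentBundle 𝓘(ℝ, E) M)}
    (hreg : IsRegularOn L U) (he : e ∈ IsManifold.maximalAtlas 𝓘(ℝ, E) ∞ M)
    {v : TangentBundle 𝓘(ℝ, E) M} (hvU : v ∈ U) (hv : v.1 ∈ e.source) (u : E)
    (hu : ∀ w : E, fderiv ℝ (fun v' => fderiv ℝ (localLagrangian L e (e v.1)) v' w)
      (velocityCoord e v) u = 0) : u = 0 := by
  have hd := mdifferentiable_of_mem_maximalAtlas he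
  set B : E →L[ℝ] E := mfderiv 𝓘(ℝ, E) 𝓘(ℝ, E) e v.1 with hB
  obtain ⟨u', rfl⟩ : ∃ u', B u' = u := hd.mfderiv_surjective hv u
  have key : u' = 0 := by
    refine hreg v hvU u' fun w' => ?_
    have h1 : (fun v' : E => fderiv ℝ (fun w : E => L ⟨v.1, w⟩) v' w') =
        (fun v' => fderiv ℝ (localLagrangian L e (e v.1)) v' (B w')) ∘ B := by
      funext v'
      rw [(hasFDerivAt_lagrangian_fiber hL he hv v').fderiv]
      rfl
    have h2 : DifferentiableAt ℝ (fun v' => fderiv ℝ (localLagrangian L e (e v.1)) v' (B w'))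
        (B v.2) := by
      have h3 : DifferentiableAt ℝ (fun v' => fiberDeriv (localLagrangian L e) (e v.1, v'))
          (B v.2) :=
        ((contDiffAt_fiberDeriv (contDiffAt_localLagrangian hL he (z := (e v.1, B v.2))
          (e.map_source hv))).differentiableAt (by simp)).comp (B v.2)
          (f := fun w => (e v.1, w)) (by fun_prop)
      exact h3.clm_apply (differentiableAt_const _)
    have h4 : fderiv ℝ (fun v' : E => fderiv ℝ (fun w : E => L ⟨v.1, w⟩) v' w') v.2 u' = 0 := by
      rw [h1, (h2.hasFDerivAt.comp (f := B) (v.2 : E) B.hasFDerivAt).fderiv]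
      exact hu (B w')
    exact h4
  rw [key, map_zero]

/-- The partial derivatives of the Legendre transform `H` of a regular Lagrangian. -/
theorem hasFDerivAt_localHamiltonian [FiniteDimensional ℝ E] {L : TangentBundle 𝓘(ℝ, E) M → ℝ}
    (hL : ContMDiff 𝓘(ℝ, E).tangent 𝓘(ℝ, ℝ) ∞ L) {U : Set (TangentBundle 𝓘(ℝ, E) M)}
    (hU : IsOpen U) (hreg : IsRegularOn L U) {H : CotangentBundle E M → ℝ}
    (hH : IsLegendreTransformOn L U H) (he : e ∈ IsManifold.maximalAtlas 𝓘(ℝ, E) ∞ M)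
    {v : TangentBundle 𝓘(ℝ, E) M} (hvU : v ∈ U) (hv : v.1 ∈ e.source) :
    HasFDerivAt (fun ζ : E × (E →L[ℝ] ℝ) => localHamiltonian H e ζ.1 ζ.2)
      ((ContinuousLinearMap.apply ℝ ℝ (velocityCoord e v)) ∘L
        (ContinuousLinearMap.snd ℝ E (E →L[ℝ] ℝ)) -
        baseDeriv (localLagrangian L e) (e v.1, velocityCoord e v) ∘L
          ContinuousLinearMap.fst ℝ E (E →L[ℝ] ℝ))
      (e v.1, fiberDeriv (localLagrangian L e) (e v.1, velocityCoord e v)) := by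
  refine hasFDerivAt_legendreTransform (z₀ := (e v.1, velocityCoord e v))
    (contDiffAt_localLagrangian hL he (e.map_source hv))
    (localLagrangian_nondegenerate hL hreg he hvU hv) ?_
  have hopen : IsOpen {z : E × E | z.1 ∈ e.target} := e.open_target.preimage continuous_fst
  have hmem : {z : E × E | z.1 ∈ e.target} ∈ 𝓝 (e v.1, velocityCoord e v) :=
    hopen.mem_nhds (e.map_source hv)
  have hcont : ContinuousAt
      (fun z : E × E => tangentMap 𝓘(ℝ, E) 𝓘(ℝ, E) e.symm ⟨z.1, z.2⟩)
      (e v.1, velocityCoord e v) :=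
    (contMDiffOn_tangentMap_symm he).continuousOn.continuousAt hmem
  have hU' : U ∈ 𝓝 (tangentMap 𝓘(ℝ, E) 𝓘(ℝ, E) e.symm ⟨e v.1, (velocityCoord e v : E)⟩) := by
    rw [tangentMap_symm_velocityCoord he hv]
    exact hU.mem_nhds hvU
  filter_upwards [hmem, hcont.preimage_mem_nhds hU'] with z hz hzU
  rw [localHamiltonian_fiberDeriv hL H he hz, hH _ hzU, energy_eq_local hL he hz]

theorem dHdx_legendreMap [FiniteDimensional ℝ E] {L : TangentBundle 𝓘(ℝ, E) M → ℝ}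
    (hL : ContMDiff 𝓘(ℝ, E).tangent 𝓘(ℝ, ℝ) ∞ L) {U : Set (TangentBundle 𝓘(ℝ, E) M)}
    (hU : IsOpen U) (hreg : IsRegularOn L U) {H : CotangentBundle E M → ℝ}
    (hH : IsLegendreTransformOn L U H) (he : e ∈ IsManifold.maximalAtlas 𝓘(ℝ, E) ∞ M)
    {v : TangentBundle 𝓘(ℝ, E) M} (hvU : v ∈ U) (hv : v.1 ∈ e.source) :
    dHdx H e (legendreMap L v) =
      -baseDeriv (localLagrangian L e) (e v.1, velocityCoord e v) := by
  rw [dHdx, momentumCoord_legendreMap hL he hv]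
  have h1 := (hasFDerivAt_localHamiltonian hL hU hreg hH he hvU hv).comp (e v.1)
    (f := fun y => (y, fiberDeriv (localLagrangian L e) (e v.1, velocityCoord e v)))
    (hasFDerivAt_prodMk_left _ _)
  refine h1.fderiv.trans ?_
  refine ContinuousLinearMap.ext fun u => ?_
  simp

theorem dHdp_legendreMap [FiniteDimensional ℝ E] {L : TangentBundle 𝓘(ℝ, E) M → ℝ}
    (hL : ContMDiff 𝓘(ℝ, E).tangent 𝓘(ℝ, ℝ) ∞ L) {U : Set (TangentBundle 𝓘(ℝ, E) M)}
    (hU : IsOpen U) (hreg : IsRegularOn L U) {H : CotangentBundle E M → ℝ}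
    (hH : IsLegendreTransformOn L U H) (he : e ∈ IsManifold.maximalAtlas 𝓘(ℝ, E) ∞ M)
    {v : TangentBundle 𝓘(ℝ, E) M} (hvU : v ∈ U) (hv : v.1 ∈ e.source) (η : E →L[ℝ] ℝ) :
    dHdp H e (legendreMap L v) η = η (velocityCoord e v) := by
  rw [dHdp, momentumCoord_legendreMap hL he hv]
  have h1 := (hasFDerivAt_localHamiltonian hL hU hreg hH he hvU hv).comp
    (fiberDeriv (localLagrangian L e) (e v.1, velocityCoord e v))
    (f := fun π => (e v.1, π)) (hasFDerivAt_prodMk_right _ _)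
  refine (congrArg (fun A : (E →L[ℝ] ℝ) →L[ℝ] ℝ => A η) h1.fderiv).trans ?_
  simp

/-- The constrained Hamilton equations are the constrained Euler-Lagrange equations. -/
theorem isConstrainedHamilton_iff [FiniteDimensional ℝ E] {L : TangentBundle 𝓘(ℝ, E) M → ℝ}
    (hL : ContMDiff 𝓘(ℝ, E).tangent 𝓘(ℝ, ℝ) ∞ L) {U : Set (TangentBundle 𝓘(ℝ, E) M)}
    (hU : IsOpen U) (hreg : IsRegularOn L U) {H : CotangentBundle E M → ℝ}
    (hH : IsLegendreTransformOn L U H) {k : ℕ} (φ : Fin k → M → ℝ) {I : Set ℝ} (hI : IsOpen I)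
    {P : ℝ → CotangentBundle E M}
    (hP : ContMDiffOn 𝓘(ℝ, ℝ) 𝓘(ℝ, E) 2 (fun t => (P t).1) I) (Λ : ℝ → Fin k → ℝ) :
    ((∀ t ∈ I, P t ∈ legendreMap L '' U) ∧ IsConstrainedHamilton H φ I P Λ) ↔
      ((∀ t ∈ I, velocityLift (fun s => (P s).1) t ∈ U ∧
        P t = legendreMap L (velocityLift (fun s => (P s).1) t)) ∧
      IsConstrainedEulerLagrange L φ I (fun t => (P t).1) Λ) := by
  have hmd : ∀ t ∈ I, MDifferentiableAt 𝓘(ℝ, ℝ) 𝓘(ℝ, E) (fun t => (P t).1) t := fun t ht =>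
    (hP.contMDiffAt (hI.mem_nhds ht)).mdifferentiableAt (by norm_num)
  -- Once P is the Legendre image of the velocity, momentum, ∂H/∂x and ∂H/∂p have the Lagrangian
  -- chart expressions, and the two systems can be compared term by term.
  have key : (∀ t ∈ I, velocityLift (fun s => (P s).1) t ∈ U ∧
      P t = legendreMap L (velocityLift (fun s => (P s).1) t)) → ∀ t ∈ I,
      ∀ e ∈ IsManifold.maximalAtlas 𝓘(ℝ, E) ∞ M, (P t).1 ∈ e.source →
      (fun s => momentumCoord e (P s)) =ᶠ[𝓝 t] dLdv L e (fun s => (P s).1) ∧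
      dHdx H e (P t) = - dLdx L e (fun s => (P s).1) t ∧
      ∀ η, dHdp H e (P t) η = η (deriv (fun s => e (P s).1) t) := by
    intro h t ht e he hte
    refine ⟨?_, ?_, fun η => ?_⟩
    · filter_upwards [hI.mem_nhds ht,
        (hmd t ht).continuousAt.preimage_mem_nhds (e.open_source.mem_nhds hte)] with s hs hse
      rw [(h s hs).2, momentumCoord_legendreMap hL he
        (v := velocityLift (fun s => (P s).1) s) hse, velocityCoord_velocityLift (hmd s hs) he hse]
      rfl
    · rw [(h t ht).2, dHdx_legendreMap hL hU hreg hH he (h t ht).1 hte,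
        velocityCoord_velocityLift (hmd t ht) he hte]
      rfl
    · rw [(h t ht).2, dHdp_legendreMap hL hU hreg hH he (h t ht).1 hte,
        velocityCoord_velocityLift (hmd t ht) he hte]
  constructor
  · rintro ⟨hPU, -, hHam⟩
    have hvel : ∀ t ∈ I, velocityLift (fun s => (P s).1) t ∈ U ∧
        P t = legendreMap L (velocityLift (fun s => (P s).1) t) := by
      intro t ht
      -- This v is a priori unrelated to the curve. The first Hamilton equation, tested on all η,
      -- identifies it with the velocity, so global injectivity of the Legendre map plays no role.
      obtain ⟨v, hvU, hv⟩ := hPU t ht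
      have hv1 : v.1 = (P t).1 := congrArg (fun p : CotangentBundle E M => p.1) hv
      have he := IsManifold.chart_mem_maximalAtlas (I := 𝓘(ℝ, E)) (n := ∞) (P t).1
      have hte := mem_chart_source E (P t).1
      obtain ⟨⟨y', hy', hη⟩, -⟩ := (hHam t ht).2 _ he hte
      have hve : v.1 ∈ (chartAt E (P t).1).source := hv1 ▸ hte
      have h1 : y' = velocityCoord (chartAt E (P t).1) v := by
        refine (SeparatingDual.eq_iff_forall_dual_eq (R := ℝ)).2 fun η => ?_
        rw [hη η, ← dHdp_legendreMap hL hU hreg hH he hvU hve η, hv]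
      have h2 : velocityLift (fun s => (P s).1) t = v := by
        rw [← tangentMap_symm_velocityCoord he hve, ← tangentMap_symm_chart (hmd t ht) he hte]
        have h3 : (chartAt E (P t).1 (P t).1, deriv (fun s => chartAt E (P t).1 (P s).1) t) =
            (chartAt E (P t).1 v.1, velocityCoord (chartAt E (P t).1) v) := by
          rw [hv1, hy'.deriv, h1]
        exact congrArg (fun z : E × E => tangentMap 𝓘(ℝ, E) 𝓘(ℝ, E) (chartAt E (P t).1).symm
          ⟨z.1, z.2⟩) h3
      rw [h2]
      exact ⟨hvU, hv.symm⟩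
    refine ⟨hvel, fun t ht => ⟨(hHam t ht).1, fun e he hte => ?_⟩⟩
    obtain ⟨h1, h2, -⟩ := key hvel t ht e he hte
    have h3 := ((hHam t ht).2 e he hte).2
    rw [h2, neg_neg] at h3
    exact h3.congr_of_eventuallyEq h1.symm
  · rintro ⟨hvel, hEL⟩
    refine ⟨fun t ht => ⟨_, (hvel t ht).1, (hvel t ht).2.symm⟩, hP.continuousOn,
      fun t ht => ⟨(hEL t ht).1, fun e he hte => ?_⟩⟩
    obtain ⟨h1, h2, h3⟩ := key hvel t ht e he hte
    refine ⟨⟨_, ((contDiffAt_chart_comp ENat.LEInfty.out (hP.contMDiffAt (hI.mem_nhds ht)) he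
      hte).differentiableAt (by norm_num)).hasDerivAt, fun η => (h3 η).symm⟩, ?_⟩
    rw [h2, neg_neg]
    exact ((hEL t ht).2 e he hte).congr_of_eventuallyEq h1

/-- Hamilton's equations are the Euler-Lagrange equations. -/
theorem isHamilton_iff [FiniteDimensional ℝ E] {L : TangentBundle 𝓘(ℝ, E) M → ℝ}
    (hL : ContMDiff 𝓘(ℝ, E).tangent 𝓘(ℝ, ℝ) ∞ L) {U : Set (TangentBundle 𝓘(ℝ, E) M)}
    (hU : IsOpen U) (hreg : IsRegularOn L U) {H : CotangentBundle E M → ℝ}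
    (hH : IsLegendreTransformOn L U H) {I : Set ℝ} (hI : IsOpen I)
    {P : ℝ → CotangentBundle E M}
    (hP : ContMDiffOn 𝓘(ℝ, ℝ) 𝓘(ℝ, E) 2 (fun t => (P t).1) I) :
    ((∀ t ∈ I, P t ∈ legendreMap L '' U) ∧ IsHamilton H I P) ↔
      ((∀ t ∈ I, velocityLift (fun s => (P s).1) t ∈ U ∧
        P t = legendreMap L (velocityLift (fun s => (P s).1) t)) ∧
      IsEulerLagrange L I (fun t => (P t).1)) := by
  rw [isHamilton_iff_zero H I P Fin.elim0 fun _ => Fin.elim0,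
    isEulerLagrange_iff_zero L I _ Fin.elim0 fun _ => Fin.elim0]
  exact isConstrainedHamilton_iff hL hU hreg hH _ hI hP _

end Legendre


/-! ### Multipliers -/

section LinearAlgebra

variable {E : Type*} [NormedAddCommGroup E] [NormedSpace ℝ E]
  {E' : Type*} [NormedAddCommGroup E'] [NormedSpace ℝ E']

/-- A form that vanishes on the range of `D` is a combination of the forms defining the range. -/
theorem exists_eq_sum_of_comp_eq_zero [FiniteDimensional ℝ E'] {k : ℕ} {D : E →L[ℝ] E'}
    (hD : Function.Injective D) {ψ : Fin k → E' →L[ℝ] ℝ} (hψ : LinearIndependent ℝ ψ)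
    (hψD : ∀ α, ψ α ∘L D = 0) (hk : Module.finrank ℝ E' = Module.finrank ℝ E + k)
    {F : E' →L[ℝ] ℝ} (hF : F ∘L D = 0) : ∃ c : Fin k → ℝ, F = ∑ α, c α • ψ α := by
  set ψ' : Fin k → Module.Dual ℝ E' := fun α => (ψ α : E' →ₗ[ℝ] ℝ) with hψ'
  have hli : LinearIndependent ℝ ψ' :=
    hψ.map' (ContinuousLinearMap.coeLM ℝ : (E' →L[ℝ] ℝ) →ₗ[ℝ] E' →ₗ[ℝ] ℝ)
      (LinearMap.ker_eq_bot.2 ContinuousLinearMap.coe_injective)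
  have hle : Submodule.span ℝ (range ψ') ≤ (LinearMap.range D.toLinearMap).dualAnnihilator := by
    rw [Submodule.span_le]
    rintro _ ⟨α, rfl⟩
    rw [SetLike.mem_coe, Submodule.mem_dualAnnihilator]
    rintro _ ⟨v, rfl⟩
    exact congrArg (fun A : E →L[ℝ] ℝ => A v) (hψD α)
  have hr : Module.finrank ℝ (LinearMap.range D.toLinearMap) = Module.finrank ℝ E :=
    LinearMap.finrank_range_of_inj hD
  -- Dimension count: the annihilator of the range has dimension dim E' - dim E = k, the number of
  -- independent forms in it.
  have heq : Submodule.span ℝ (range ψ') = (LinearMap.range D.toLinearMap).dualAnnihilator := by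
    refine Submodule.eq_of_le_of_finrank_eq hle ?_
    have h1 := Subspace.finrank_add_finrank_dualAnnihilator_eq (LinearMap.range D.toLinearMap)
    rw [finrank_span_eq_card hli, Fintype.card_fin]
    omega
  have hmem : (F : E' →ₗ[ℝ] ℝ) ∈ Submodule.span ℝ (range ψ') := by
    rw [heq, Submodule.mem_dualAnnihilator]
    rintro _ ⟨v, rfl⟩
    exact congrArg (fun A : E →L[ℝ] ℝ => A v) hF
  obtain ⟨c, hc⟩ := (Submodule.mem_span_range_iff_exists_fun ℝ).1 hmem
  refine ⟨c, ContinuousLinearMap.ext fun v => ?_⟩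
  have := congrArg (fun A : E' →ₗ[ℝ] ℝ => A v) hc
  simpa [hψ'] using this.symm

/-- The coefficients of a combination of independent vectors depend smoothly on the data. -/
theorem exists_coefficient_map [FiniteDimensional ℝ E] {k : ℕ} {ψ : Fin k → ℝ → E} {t₀ : ℝ}
    (hψ : ∀ α, ContDiffAt ℝ 1 (ψ α) t₀) (hli : LinearIndependent ℝ fun α => ψ α t₀) :
    ∃ S : ℝ → E →L[ℝ] (Fin k → ℝ), ContDiffAt ℝ 1 S t₀ ∧
      ∀ᶠ t in 𝓝 t₀, ∀ c : Fin k → ℝ, S t (∑ α, c α • ψ α t) = c := by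
  set T : ℝ → (Fin k → ℝ) →L[ℝ] E := fun t =>
    ∑ α, (ContinuousLinearMap.proj (R := ℝ) (φ := fun _ : Fin k => ℝ) α).smulRight (ψ α t) with hT
  have hTapp : ∀ t c, T t c = ∑ α, c α • ψ α t := by
    intro t c
    simp [hT]
  have hTs : ContDiffAt ℝ 1 T t₀ := by
    refine ContDiffAt.sum fun α _ => ?_
    exact ((ContinuousLinearMap.smulRightL ℝ (Fin k → ℝ) E
      (ContinuousLinearMap.proj (R := ℝ) (φ := fun _ : Fin k => ℝ) α)).contDiff.contDiffAt).comp
      t₀ (hψ α)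
  have hinj : LinearMap.ker (T t₀).toLinearMap = ⊥ := by
    rw [LinearMap.ker_eq_bot']
    intro c hc
    have hc' : ∑ α, c α • ψ α t₀ = 0 := (hTapp t₀ c).symm.trans hc
    exact funext (Fintype.linearIndependent_iff.1 hli c hc')
  -- With R a fixed left inverse of T t₀, the map R ∘ T t is the identity at t₀, hence invertible
  -- nearby, and (R ∘ T t)⁻¹ ∘ R is a left inverse of T t that is C¹ in t.
  obtain ⟨R₀, hR₀⟩ := LinearMap.exists_leftInverse_of_injective _ hinj
  set R : E →L[ℝ] (Fin k → ℝ) := LinearMap.toContinuousLinearMap R₀ with hR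
  have hRT : R ∘L T t₀ = 1 := by
    refine ContinuousLinearMap.ext fun c => ?_
    exact congrArg (fun A : (Fin k → ℝ) →ₗ[ℝ] (Fin k → ℝ) => A c) hR₀
  have hRTs : ContDiffAt ℝ 1 (fun t => R ∘L T t) t₀ := contDiffAt_const.clm_comp hTs
  have hunit : IsUnit (R ∘L T t₀) := by rw [hRT]; exact isUnit_one
  have hinv : ContDiffAt ℝ 1 (fun t => Ring.inverse (R ∘L T t)) t₀ := by
    have h1 := contDiffAt_ringInverse (n := 1) ℝ (1 : ((Fin k → ℝ) →L[ℝ] (Fin k → ℝ))ˣ)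
    rw [Units.val_one, ← hRT] at h1
    exact h1.comp t₀ hRTs
  refine ⟨fun t => Ring.inverse (R ∘L T t) ∘L R, hinv.clm_comp contDiffAt_const, ?_⟩
  have hev : ∀ᶠ t in 𝓝 t₀, IsUnit (R ∘L T t) :=
    hRTs.continuousAt.eventually (Units.isOpen.mem_nhds hunit)
  filter_upwards [hev] with t ht c
  rw [← hTapp]
  exact congrArg (fun A : (Fin k → ℝ) →L[ℝ] (Fin k → ℝ) => A c) (Ring.inverse_mul_cancel _ ht)

end LinearAlgebra

/-! ### Constrained equations: chart independence, uniqueness and regularity of multipliers -/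

section Constrained

variable {E : Type*} [NormedAddCommGroup E] [NormedSpace ℝ E]
  {M : Type*} [TopologicalSpace M] [ChartedSpace E M]
  {e e' : OpenPartialHomeomorph M E} {k : ℕ} {L : TangentBundle 𝓘(ℝ, E) M → ℝ}
  {φ : Fin k → M → ℝ} {I : Set ℝ} {q : ℝ → M} {Λ : ℝ → Fin k → ℝ}

theorem IsConstrainedEulerLagrange.congr (h : IsConstrainedEulerLagrange L φ I q Λ)
    (hI : IsOpen I) {q' : ℝ → M} (hq : ∀ t ∈ I, q t = q' t) {Λ' : ℝ → Fin k → ℝ}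
    (hΛ : ∀ t ∈ I, Λ t = Λ' t) : IsConstrainedEulerLagrange L φ I q' Λ' := by
  intro t ht
  have hev : q =ᶠ[𝓝 t] q' := Filter.eventually_of_mem (hI.mem_nhds ht) hq
  refine ⟨fun α => hq t ht ▸ (h t ht).1 α, fun e he hte => ?_⟩
  rw [← hq t ht] at hte
  have h1 := (h t ht).2 e he hte
  rw [dLdx_congr L e hev, hΛ t ht, hq t ht] at h1
  exact h1.congr_of_eventuallyEq (dLdv_congr L e hev).symm

theorem contDiffAt_dFun_comp (hφ : ∀ α, ContMDiff 𝓘(ℝ, E) 𝓘(ℝ, ℝ) ∞ (φ α)) {t : ℝ}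
    (hq : ContMDiffAt 𝓘(ℝ, ℝ) 𝓘(ℝ, E) 2 q t) (he : e ∈ IsManifold.maximalAtlas 𝓘(ℝ, E) ∞ M)
    (hte : q t ∈ e.source) (α : Fin k) : ContDiffAt ℝ 1 (fun s => dFun (φ α) e (q s)) t :=
  ContDiffAt.comp t (g := fderiv ℝ fun y => φ α (e.symm y)) (f := fun s => e (q s))
    (((contDiffAt_fun_comp_symm (hφ α) he (e.map_source hte)).fderiv_right (m := ∞)
      (by simp)).of_le (mod_cast le_top))
    ((contDiffAt_chart_comp ENat.LEInfty.out hq he hte).of_le (by norm_num))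

theorem hasDerivAt_dFun_comp (hφ : ∀ α, ContMDiff 𝓘(ℝ, E) 𝓘(ℝ, ℝ) ∞ (φ α)) {t : ℝ}
    (hq : ContMDiffAt 𝓘(ℝ, ℝ) 𝓘(ℝ, E) 2 q t) (he : e ∈ IsManifold.maximalAtlas 𝓘(ℝ, E) ∞ M)
    (hte : q t ∈ e.source) (α : Fin k) : HasDerivAt (fun s => dFun (φ α) e (q s))
      (ddFun (φ α) e (q t) (deriv (fun s => e (q s)) t)) t :=
  (((contDiffAt_fun_comp_symm (hφ α) he (e.map_source hte)).fderiv_right (m := ∞)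
      (by simp)).differentiableAt (by simp)).hasFDerivAt.comp_hasDerivAt t
    ((contDiffAt_chart_comp ENat.LEInfty.out hq he hte).differentiableAt (by norm_num)).hasDerivAt

/-- Differentiate φ^α(q(t)) = 0 in time: the velocity constraints of the two-multiplier system are
automatic. -/
theorem dFun_velocity_eq_zero (hφ : ∀ α, ContMDiff 𝓘(ℝ, E) 𝓘(ℝ, ℝ) ∞ (φ α)) (hI : IsOpen I)
    (hzero : ∀ t ∈ I, ∀ α, φ α (q t) = 0) {t : ℝ} (ht : t ∈ I)
    (hq : ContMDiffAt 𝓘(ℝ, ℝ) 𝓘(ℝ, E) 2 q t) (he : e ∈ IsManifold.maximalAtlas 𝓘(ℝ, E) ∞ M)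
    (hte : q t ∈ e.source) (α : Fin k) :
    dFun (φ α) e (q t) (deriv (fun s => e (q s)) t) = 0 := by
  have h1 : HasDerivAt (fun s => φ α (e.symm (e (q s))))
      (dFun (φ α) e (q t) (deriv (fun s => e (q s)) t)) t :=
    ((contDiffAt_fun_comp_symm (hφ α) he (e.map_source hte)).differentiableAt
      (by simp)).hasFDerivAt.comp_hasDerivAt (f := fun s => e (q s)) t
    ((contDiffAt_chart_comp ENat.LEInfty.out hq he hte).differentiableAt (by norm_num)).hasDerivAt
  have h2 : (fun s => φ α (e.symm (e (q s)))) =ᶠ[𝓝 t] fun _ => 0 := by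
    filter_upwards [hI.mem_nhds ht,
      hq.continuousAt.preimage_mem_nhds (e.open_source.mem_nhds hte)] with s hs hse
    rw [e.left_inv hse, hzero s hs α]
  exact h1.unique ((hasDerivAt_const t (0 : ℝ)).congr_of_eventuallyEq h2)

variable [IsManifold 𝓘(ℝ, E) ∞ M]

/-- The constrained equations need to be checked in one chart only. -/
theorem constrained_of_chart (hL : ContMDiff 𝓘(ℝ, E).tangent 𝓘(ℝ, ℝ) ∞ L)
    (hφ : ∀ α, ContMDiff 𝓘(ℝ, E) 𝓘(ℝ, ℝ) ∞ (φ α)) {t : ℝ}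
    (hq : ContMDiffAt 𝓘(ℝ, ℝ) 𝓘(ℝ, E) 2 q t)
    (he : e ∈ IsManifold.maximalAtlas 𝓘(ℝ, E) ∞ M) (hte : q t ∈ e.source)
    (he' : e' ∈ IsManifold.maximalAtlas 𝓘(ℝ, E) ∞ M) (hte' : q t ∈ e'.source) {c : Fin k → ℝ}
    (h : HasDerivAt (dLdv L e' q) (dLdx L e' q t - ∑ α, c α • dFun (φ α) e' (q t)) t) :
    HasDerivAt (dLdv L e q) (dLdx L e q t - ∑ α, c α • dFun (φ α) e (q t)) t := by
  -- Naturality under the identity map, read in two charts, with the constraint force as F.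
  have h1 := hasDerivAt_dLdv_pullback (f := id) (L := L) (F := -∑ α, c α • dFun (φ α) e' (q t)) hL
    contMDiff_id (fun v => by rw [tangentMap_id]; rfl) hq he hte he' hte'
    (h.congr_deriv (sub_eq_add_neg _ _))
  refine h1.congr_deriv ?_
  rw [sub_eq_add_neg, ContinuousLinearMap.neg_comp, ContinuousLinearMap.finsetSum_comp]
  congr 2
  refine Finset.sum_congr rfl fun α _ => ?_
  rw [ContinuousLinearMap.smul_comp]
  congr 1
  exact dFun_comp (f := id) (hφ α) contMDiff_id he hte he' hte'

/-- The momentum has only one derivative, so both families give the same combination of the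
independent forms dφ^α. -/
theorem IsConstrainedEulerLagrange.multiplier_unique
    (hφ : ∀ α, ContMDiff 𝓘(ℝ, E) 𝓘(ℝ, ℝ) ∞ (φ α))
    (hindep : ∀ p, (∀ α, φ α p = 0) → LinearIndependent ℝ (fun α => differential E (φ α) p))
    (h : IsConstrainedEulerLagrange L φ I q Λ) {Λ' : ℝ → Fin k → ℝ}
    (h' : IsConstrainedEulerLagrange L φ I q Λ') : EqOn Λ Λ' I := by
  intro t ht
  have he := IsManifold.chart_mem_maximalAtlas (I := 𝓘(ℝ, E)) (n := ∞) (q t)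
  have hte := mem_chart_source E (q t)
  have hli := linearIndependent_dFun hφ (hindep _ (h t ht).1) he hte
  have h1 := sub_right_injective (((h t ht).2 _ he hte).unique ((h' t ht).2 _ he hte))
  rw [Fintype.linearIndependent_iff] at hli
  funext α
  refine sub_eq_zero.1 (hli (fun α => Λ t α - Λ' t α) ?_ α)
  simp only [sub_smul, Finset.sum_sub_distrib]
  exact sub_eq_zero.2 h1

variable [FiniteDimensional ℝ E]

/-- Locally Λ is recovered by applying a C¹ coefficient map to the Euler-Lagrange residual, which is
continuous along a C² curve. -/
theorem IsConstrainedEulerLagrange.continuousOn_multiplier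
    (hL : ContMDiff 𝓘(ℝ, E).tangent 𝓘(ℝ, ℝ) ∞ L)
    (hφ : ∀ α, ContMDiff 𝓘(ℝ, E) 𝓘(ℝ, ℝ) ∞ (φ α))
    (hindep : ∀ p, (∀ α, φ α p = 0) → LinearIndependent ℝ (fun α => differential E (φ α) p))
    (hI : IsOpen I) (hq : ContMDiffOn 𝓘(ℝ, ℝ) 𝓘(ℝ, E) 2 q I)
    (h : IsConstrainedEulerLagrange L φ I q Λ) : ContinuousOn Λ I := by
  intro t ht
  refine ContinuousAt.continuousWithinAt ?_
  set e := chartAt E (q t) with hedef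
  have he : e ∈ IsManifold.maximalAtlas 𝓘(ℝ, E) ∞ M :=
    IsManifold.chart_mem_maximalAtlas (I := 𝓘(ℝ, E)) (n := ∞) (q t)
  have hte : q t ∈ e.source := mem_chart_source E (q t)
  have hqt := hq.contMDiffAt (hI.mem_nhds ht)
  obtain ⟨S, hS, hSinv⟩ := exists_coefficient_map (ψ := fun α s => dFun (φ α) e (q s))
    (contDiffAt_dFun_comp hφ hqt he hte) (linearIndependent_dFun hφ (hindep _ (h t ht).1) he hte)
  have h1 : Λ =ᶠ[𝓝 t] fun s => S s (dLdx L e q s - deriv (dLdv L e q) s) := by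
    filter_upwards [hI.mem_nhds ht, hSinv,
      hqt.continuousAt.preimage_mem_nhds (e.open_source.mem_nhds hte)] with s hs hs2 hse
    rw [((h s hs).2 e he hse).deriv, sub_sub_cancel, hs2]
  have h2 : ContinuousAt (deriv (dLdv L e q)) t := by
    have := (contDiffAt_dLdv hL hqt he hte).fderiv_right (m := 0) (by norm_num)
    have := (this.clm_apply (contDiffAt_const (c := (1 : ℝ)))).continuousAt
    simpa only [fderiv_apply_one_eq_deriv] using this
  exact (hS.continuousAt.clm_apply ((continuousAt_dLdx hL hqt he hte).sub h2)).congr h1.symm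

/-- By the product rule the derivative of μ_α dφ^α contains the d²φ^α term of the two-multiplier
equation; subtracting leaves the force -(μ' - lam)_α dφ^α. -/
theorem isTwoMultiplierSolution_iff
    (hL : ContMDiff 𝓘(ℝ, E).tangent 𝓘(ℝ, ℝ) ∞ L)
    (hφ : ∀ α, ContMDiff 𝓘(ℝ, E) 𝓘(ℝ, ℝ) ∞ (φ α))
    (hindep : ∀ p, (∀ α, φ α p = 0) → LinearIndependent ℝ (fun α => differential E (φ α) p))
    (hI : IsOpen I) (hq : ContMDiffOn 𝓘(ℝ, ℝ) 𝓘(ℝ, E) 2 q I) (lam μ : ℝ → Fin k → ℝ) :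
    IsTwoMultiplierSolution L φ I q lam μ ↔ (∀ t ∈ I, DifferentiableAt ℝ μ t) ∧
      IsConstrainedEulerLagrange L φ I q (fun t => deriv μ t - lam t) := by
  have hqt : ∀ t ∈ I, ContMDiffAt 𝓘(ℝ, ℝ) 𝓘(ℝ, E) 2 q t :=
    fun t ht => hq.contMDiffAt (hI.mem_nhds ht)
  have hprod : ∀ t ∈ I, DifferentiableAt ℝ μ t →
      ∀ e ∈ IsManifold.maximalAtlas 𝓘(ℝ, E) ∞ M, q t ∈ e.source →
      HasDerivAt (fun s => ∑ α, μ s α • dFun (φ α) e (q s))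
        (∑ α, (μ t α • ddFun (φ α) e (q t) (deriv (fun s => e (q s)) t) +
          deriv μ t α • dFun (φ α) e (q t))) t := by
    intro t ht hμ e he hte
    refine HasDerivAt.fun_sum fun α _ => ?_
    exact (hasDerivAt_pi.1 hμ.hasDerivAt α).fun_smul (hasDerivAt_dFun_comp hφ (hqt t ht) he hte α)
  have hsub : ∀ (c d : Fin k → ℝ) (ψ : Fin k → E →L[ℝ] ℝ),
      ∑ α, (c - d) α • ψ α = ∑ α, c α • ψ α - ∑ α, d α • ψ α := by
    intro c d ψ
    rw [← Finset.sum_sub_distrib]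
    exact Finset.sum_congr rfl fun α _ => sub_smul (c α) (d α) (ψ α)
  constructor
  · intro h
    have hμ : ∀ t ∈ I, DifferentiableAt ℝ μ t := by
      intro t ht
      set e := chartAt E (q t) with hedef
      have he : e ∈ IsManifold.maximalAtlas 𝓘(ℝ, E) ∞ M :=
        IsManifold.chart_mem_maximalAtlas (I := 𝓘(ℝ, E)) (n := ∞) (q t)
      have hte : q t ∈ e.source := mem_chart_source E (q t)
      obtain ⟨S, hS, hSinv⟩ := exists_coefficient_map (ψ := fun α s => dFun (φ α) e (q s))
        (contDiffAt_dFun_comp hφ (hqt t ht) he hte)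
        (linearIndependent_dFun hφ (hindep _ (h t ht).1) he hte)
      -- Only the sum of ∂L/∂q̇ and μ_α dφ^α is assumed differentiable. Since ∂L/∂q̇ is C¹, so is
      -- the second summand differentiable, and the coefficient map extracts μ from it.
      have h1 := ((h t ht).2 e he hte).2.differentiableAt.fun_sub
        ((contDiffAt_dLdv hL (hqt t ht) he hte).differentiableAt one_ne_zero)
      refine ((hS.differentiableAt one_ne_zero).clm_apply h1).congr_of_eventuallyEq ?_
      filter_upwards [hSinv] with s hs
      rw [add_sub_cancel_left, hs]
    refine ⟨hμ, fun t ht => ⟨(h t ht).1, fun e he hte => ?_⟩⟩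
    have h1 := ((h t ht).2 e he hte).2.fun_sub (hprod t ht (hμ t ht) e he hte)
    simp only [add_sub_cancel_right] at h1
    refine h1.congr_deriv ?_
    rw [Finset.sum_add_distrib, hsub]
    abel
  · rintro ⟨hμ, h⟩ t ht
    refine ⟨(h t ht).1, fun e he hte => ⟨fun α =>
      dFun_velocity_eq_zero hφ hI (fun t ht => (h t ht).1) ht (hqt t ht) he hte α, ?_⟩⟩
    refine (((h t ht).2 e he hte).fun_add (hprod t ht (hμ t ht) e he hte)).congr_deriv ?_
    rw [Finset.sum_add_distrib, hsub]
    abel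

theorem IsConstrainedEulerLagrange.exists_two_pairs (hk : 0 < k)
    (hL : ContMDiff 𝓘(ℝ, E).tangent 𝓘(ℝ, ℝ) ∞ L)
    (hφ : ∀ α, ContMDiff 𝓘(ℝ, E) 𝓘(ℝ, ℝ) ∞ (φ α))
    (hindep : ∀ p, (∀ α, φ α p = 0) → LinearIndependent ℝ (fun α => differential E (φ α) p))
    (hI : IsOpen I) (hq : ContMDiffOn 𝓘(ℝ, ℝ) 𝓘(ℝ, E) 2 q I)
    (h : IsConstrainedEulerLagrange L φ I q Λ) :
    ∃ lam₁ μ₁ lam₂ μ₂ : ℝ → Fin k → ℝ, IsTwoMultiplierSolution L φ I q lam₁ μ₁ ∧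
      IsTwoMultiplierSolution L φ I q lam₂ μ₂ ∧ ∀ t ∈ I, lam₁ t ≠ lam₂ t ∧ μ₁ t ≠ μ₂ t := by
  have hexp : ∀ t, HasDerivAt (fun t (_ : Fin k) => Real.exp t) (fun _ => Real.exp t) t :=
    fun t => hasDerivAt_pi.2 fun _ => Real.hasDerivAt_exp t
  -- Any differentiable μ with lam = μ' - Λ works. The choices 0 and exp differ at every time, as do
  -- their derivatives; since k > 0 there is a component in which to see it.
  refine ⟨fun t => -Λ t, fun _ => 0, fun t => (fun _ => Real.exp t) - Λ t,
    fun t _ => Real.exp t, ?_, ?_, fun t _ => ⟨fun h1 => ?_, fun h1 => ?_⟩⟩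
  · rw [isTwoMultiplierSolution_iff hL hφ hindep hI hq]
    exact ⟨fun t _ => differentiableAt_const _, by simpa using h⟩
  · rw [isTwoMultiplierSolution_iff hL hφ hindep hI hq]
    refine ⟨fun t _ => (hexp t).differentiableAt, ?_⟩
    simpa only [(hexp _).deriv, sub_sub_cancel] using h
  · have h2 := congrFun h1 ⟨0, hk⟩
    have h3 := Real.exp_pos t
    simp only [Pi.neg_apply, Pi.sub_apply] at h2
    linarith
  · exact (Real.exp_pos t).ne (congrFun h1 ⟨0, hk⟩)

end Constrained


/-! ### Embedded submanifolds -/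

section Submanifold

variable {E : Type*} [NormedAddCommGroup E] [NormedSpace ℝ E]
  {N : Type*} [TopologicalSpace N] [ChartedSpace E N]
  {E' : Type*} [NormedAddCommGroup E'] [NormedSpace ℝ E']
  {Q : Type*} [TopologicalSpace Q] [ChartedSpace E' Q] {i : N → Q}

/-- An immersion has smooth local left inverses. -/
theorem exists_localRetraction {x : N}
    (h : Manifold.IsImmersionAt 𝓘(ℝ, E) 𝓘(ℝ, E') ∞ i x) :
    ∃ ρ : Q → N, ContMDiffAt 𝓘(ℝ, E') 𝓘(ℝ, E) ∞ ρ (i x) ∧ ∀ᶠ y in 𝓝 x, ρ (i y) = y := by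
  have hform : ∀ y ∈ h.domChart.source, h.codChart (i y) = h.equiv (h.domChart y, 0) := by
    intro y hy
    have h0 : h.domChart y ∈ (h.domChart.extend 𝓘(ℝ, E)).target := by
      simpa using h.domChart.map_source hy
    have h1 := h.writtenInCharts h0
    simpa [h.domChart.left_inv hy] using h1
  have hval : ∀ y ∈ h.domChart.source, (h.equiv.symm (h.codChart (i y))).1 = h.domChart y := by
    intro y hy
    rw [hform y hy, h.equiv.symm_apply_apply]
  -- In adapted charts the immersion is u ↦ (u, 0), so projection to the first factor is a left
  -- inverse.
  refine ⟨fun p => h.domChart.symm (h.equiv.symm (h.codChart p)).1, ?_, ?_⟩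
  · have h1 : ContMDiffAt 𝓘(ℝ, E') 𝓘(ℝ, E') ∞ h.codChart (i x) :=
      contMDiffAt_of_mem_maximalAtlas h.codChart_mem_maximalAtlas h.mem_codChart_source
    have h2 : ContMDiffAt 𝓘(ℝ, E') 𝓘(ℝ, E) ∞ (fun w : E' => (h.equiv.symm w).1)
        (h.codChart (i x)) :=
      (contDiff_fst.comp h.equiv.symm.contDiff).contMDiff.contMDiffAt
    have h3 : ContMDiffAt 𝓘(ℝ, E) 𝓘(ℝ, E) ∞ h.domChart.symm
        (h.equiv.symm (h.codChart (i x))).1 := by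
      rw [hval x h.mem_domChart_source]
      exact contMDiffAt_symm_of_mem_maximalAtlas h.domChart_mem_maximalAtlas
        (h.domChart.map_source h.mem_domChart_source)
    exact h3.comp (i x) (h2.comp (i x) h1)
  · filter_upwards [h.domChart.open_source.mem_nhds h.mem_domChart_source] with y hy
    simp only [hval y hy, h.domChart.left_inv hy]

/-- Differentiating ρ ∘ i = id gives a linear left inverse. -/
theorem mfderiv_injective_of_localRetraction {x : N}
    (hi : MDifferentiableAt 𝓘(ℝ, E) 𝓘(ℝ, E') i x)
    (hret : ∃ ρ : Q → N, ContMDiffAt 𝓘(ℝ, E') 𝓘(ℝ, E) ∞ ρ (i x) ∧ ∀ᶠ y in 𝓝 x, ρ (i y) = y) :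
    Function.Injective (mfderiv 𝓘(ℝ, E) 𝓘(ℝ, E') i x) := by
  obtain ⟨ρ, hρ, hρi⟩ := hret
  have h1 := mfderiv_comp x (hρ.mdifferentiableAt (by simp)) hi
  have h2 : ρ ∘ i =ᶠ[𝓝 x] id := hρi
  have h3 := h2.mfderiv_eq (I := 𝓘(ℝ, E)) (I' := 𝓘(ℝ, E))
  rw [mfderiv_id] at h3
  intro u w huw
  have h4 : ∀ u : E, mfderiv 𝓘(ℝ, E') 𝓘(ℝ, E) ρ (i x) (mfderiv 𝓘(ℝ, E) 𝓘(ℝ, E') i x u) = u := by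
    intro u
    have h5 := congrArg (fun A : E →L[ℝ] E => A u) h1
    have h6 := congrArg (fun A : E →L[ℝ] E => A u) h3
    exact h5.symm.trans h6
  rw [← h4 u, ← h4 w, huw]

theorem tangentMap_injective (hinj : Function.Injective i)
    (hd : ∀ x, Function.Injective (mfderiv 𝓘(ℝ, E) 𝓘(ℝ, E') i x)) :
    Function.Injective (tangentMap 𝓘(ℝ, E) 𝓘(ℝ, E') i) := by
  rintro ⟨x, v⟩ ⟨y, w⟩ h
  obtain rfl : x = y := hinj (congrArg (fun p : TangentBundle 𝓘(ℝ, E') Q => p.1) h)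
  have h1 : mfderiv 𝓘(ℝ, E) 𝓘(ℝ, E') i x v = mfderiv 𝓘(ℝ, E) 𝓘(ℝ, E') i x w :=
    Bundle.TotalSpace.mk_inj.1 h
  rw [hd x h1]

theorem fderiv_writtenInCharts_injective {x : N} {e : OpenPartialHomeomorph N E}
    {e' : OpenPartialHomeomorph Q E'} (hi : ContMDiff 𝓘(ℝ, E) 𝓘(ℝ, E') ∞ i)
    (hret : ∃ ρ : Q → N, ContMDiffAt 𝓘(ℝ, E') 𝓘(ℝ, E) ∞ ρ (i x) ∧ ∀ᶠ y in 𝓝 x, ρ (i y) = y)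
    (he : e ∈ IsManifold.maximalAtlas 𝓘(ℝ, E) ∞ N) (hx : x ∈ e.source)
    (he' : e' ∈ IsManifold.maximalAtlas 𝓘(ℝ, E') ∞ Q) (hx' : i x ∈ e'.source) :
    Function.Injective (fderiv ℝ (fun y => e' (i (e.symm y))) (e x)) := by
  have hd := mdifferentiable_of_mem_maximalAtlas he
  have hd' := mdifferentiable_of_mem_maximalAtlas he'
  have hsymm := hd.symm.mdifferentiableAt (e.map_source hx)
  have h1 : MDifferentiableAt 𝓘(ℝ, E) 𝓘(ℝ, E') i (e.symm (e x)) :=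
    hi.mdifferentiable (by simp) _
  have h2 : MDifferentiableAt 𝓘(ℝ, E') 𝓘(ℝ, E') e' (i (e.symm (e x))) := by
    rw [e.left_inv hx]
    exact hd'.mdifferentiableAt hx'
  have hinj1 := hd.symm.mfderiv_injective (e.map_source hx)
  have hinj2 : Function.Injective (mfderiv 𝓘(ℝ, E) 𝓘(ℝ, E') i (e.symm (e x))) := by
    rw [e.left_inv hx]
    exact mfderiv_injective_of_localRetraction (hi.mdifferentiable (by simp) _) hret
  have hinj3 : Function.Injective (mfderiv 𝓘(ℝ, E') 𝓘(ℝ, E') e' (i (e.symm (e x)))) := by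
    rw [e.left_inv hx]
    exact hd'.mfderiv_injective hx'
  have h3 := mfderiv_comp (e x) (f := fun y => i (e.symm y)) (g := e') h2 (h1.comp (e x) hsymm)
  have h4 := mfderiv_comp (e x) (f := e.symm) (g := i) h1 hsymm
  have h5 : ∀ u : E, fderiv ℝ (fun y => e' (i (e.symm y))) (e x) u =
      mfderiv 𝓘(ℝ, E') 𝓘(ℝ, E') e' (i (e.symm (e x)))
        (mfderiv 𝓘(ℝ, E) 𝓘(ℝ, E') i (e.symm (e x))
          (mfderiv 𝓘(ℝ, E) 𝓘(ℝ, E) e.symm (e x) u)) := by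
    intro u
    have h6 := congrArg (fun A : E →L[ℝ] E' => A u) h3
    have h7 := congrArg (fun A : E →L[ℝ] E' => A u) h4
    have h8 := congrArg (fun A : E →L[ℝ] E' => A u)
      (mfderiv_eq_fderiv (𝕜 := ℝ) (f := fun y => e' (i (e.symm y))) (x := e x))
    refine h8.symm.trans (h6.trans ?_)
    exact congrArg (mfderiv 𝓘(ℝ, E') 𝓘(ℝ, E') e' (i (e.symm (e x)))) h7
  intro u w huw
  rw [h5, h5] at huw
  exact hinj1 (hinj2 (hinj3 huw))

/-- A `C²` curve with values in an embedded submanifold is a `C²` curve in the submanifold. -/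
theorem exists_lift_of_mem_range {q : ℝ → Q} {I : Set ℝ} (hI : IsOpen I) (hne : I.Nonempty)
    (hi : Topology.IsEmbedding i)
    (hret : ∀ x, ∃ ρ : Q → N, ContMDiffAt 𝓘(ℝ, E') 𝓘(ℝ, E) ∞ ρ (i x) ∧ ∀ᶠ y in 𝓝 x, ρ (i y) = y)
    (hq : ContMDiffOn 𝓘(ℝ, ℝ) 𝓘(ℝ, E') 2 q I) (hqi : ∀ t ∈ I, q t ∈ range i) :
    ∃ x : ℝ → N, ContMDiffOn 𝓘(ℝ, ℝ) 𝓘(ℝ, E) 2 x I ∧ ∀ t ∈ I, q t = i (x t) := by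
  obtain ⟨t₀, ht₀⟩ := hne
  obtain ⟨x₀, -⟩ := hqi t₀ ht₀
  have : Nonempty N := ⟨x₀⟩
  set x : ℝ → N := fun t => Function.invFun i (q t) with hx
  have hix : ∀ t ∈ I, i (x t) = q t := fun t ht => Function.invFun_eq (hqi t ht)
  -- Continuity must come first, from the embedding topology: it keeps x near a given point, where ρ
  -- ∘ i = id and therefore x = ρ ∘ q.
  have hcont : ContinuousOn x I := by
    rw [hi.isInducing.continuousOn_iff]
    exact hq.continuousOn.congr hix
  refine ⟨x, fun t ht => ContMDiffAt.contMDiffWithinAt ?_, fun t ht => (hix t ht).symm⟩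
  obtain ⟨ρ, hρ, hρi⟩ := hret (x t)
  have h1 : ContMDiffAt 𝓘(ℝ, ℝ) 𝓘(ℝ, E) 2 (fun s => ρ (q s)) t := by
    rw [hix t ht] at hρ
    exact (hρ.of_le ENat.LEInfty.out).comp t (hq.contMDiffAt (hI.mem_nhds ht))
  refine h1.congr_of_eventuallyEq ?_
  filter_upwards [hI.mem_nhds ht, (hcont.continuousAt (hI.mem_nhds ht)).eventually hρi] with s hs hs'
  rw [← hix s hs, hs']

variable [IsManifold 𝓘(ℝ, E) ∞ N] [IsManifold 𝓘(ℝ, E') ∞ Q] [FiniteDimensional ℝ E']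

/-- Intrinsic solutions are the extrinsic solutions for some multipliers. -/
theorem isEulerLagrange_iff_exists_multiplier {k : ℕ}
    (hk : Module.finrank ℝ E' = Module.finrank ℝ E + k)
    (hi : ContMDiff 𝓘(ℝ, E) 𝓘(ℝ, E') ∞ i)
    (hret : ∀ x, ∃ ρ : Q → N, ContMDiffAt 𝓘(ℝ, E') 𝓘(ℝ, E) ∞ ρ (i x) ∧ ∀ᶠ y in 𝓝 x, ρ (i y) = y)
    {φ : Fin k → Q → ℝ} (hφ : ∀ α, ContMDiff 𝓘(ℝ, E') 𝓘(ℝ, ℝ) ∞ (φ α))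
    (hφi : ∀ x α, φ α (i x) = 0)
    (hindep : ∀ x, LinearIndependent ℝ (fun α => differential E' (φ α) (i x)))
    {L : TangentBundle 𝓘(ℝ, E) N → ℝ} {L' : TangentBundle 𝓘(ℝ, E') Q → ℝ}
    (hL' : ContMDiff 𝓘(ℝ, E').tangent 𝓘(ℝ, ℝ) ∞ L')
    (hLL' : ∀ v, L' (tangentMap 𝓘(ℝ, E) 𝓘(ℝ, E') i v) = L v) {I : Set ℝ} (hI : IsOpen I)
    {x : ℝ → N} (hx : ContMDiffOn 𝓘(ℝ, ℝ) 𝓘(ℝ, E) 2 x I) :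
    IsEulerLagrange L I x ↔
      ∃ Λ : ℝ → Fin k → ℝ, IsConstrainedEulerLagrange L' φ I (fun t => i (x t)) Λ := by
  have hxt : ∀ t ∈ I, ContMDiffAt 𝓘(ℝ, ℝ) 𝓘(ℝ, E) 2 x t :=
    fun t ht => hx.contMDiffAt (hI.mem_nhds ht)
  have hqt : ∀ t ∈ I, ContMDiffAt 𝓘(ℝ, ℝ) 𝓘(ℝ, E') 2 (fun t => i (x t)) t :=
    fun t ht => (hi.contMDiffAt.of_le ENat.LEInfty.out).comp t (hxt t ht)
  -- The functions φ^α ∘ i vanish identically, so their differentials, the pullbacks of dφ^α, do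
  -- too.
  have hdφ : ∀ (e : OpenPartialHomeomorph N E), e ∈ IsManifold.maximalAtlas 𝓘(ℝ, E) ∞ N →
      ∀ (e' : OpenPartialHomeomorph Q E'), e' ∈ IsManifold.maximalAtlas 𝓘(ℝ, E') ∞ Q →
      ∀ x ∈ e.source, i x ∈ e'.source → ∀ α,
      dFun (φ α) e' (i x) ∘L fderiv ℝ (fun y => e' (i (e.symm y))) (e x) = 0 := by
    intro e he e' he' x hx hx' α
    rw [dFun_comp (hφ α) hi he hx he' hx']
    simp [dFun, hφi]
  constructor
  · intro h
    -- One vector c must serve all charts at t; it is found in the preferred chart and transferred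
    -- by `constrained_of_chart`. Times outside I receive the value 0, so that `choose` gives a
    -- function on all of ℝ.
    have hpt : ∀ t, ∃ c : Fin k → ℝ, t ∈ I →
        ∀ e ∈ IsManifold.maximalAtlas 𝓘(ℝ, E') ∞ Q, i (x t) ∈ e.source →
        HasDerivAt (dLdv L' e fun t => i (x t))
          (dLdx L' e (fun t => i (x t)) t - ∑ α, c α • dFun (φ α) e (i (x t))) t := by
      intro t
      by_cases ht : t ∈ I
      swap
      · exact ⟨0, fun h => absurd h ht⟩
      set e := chartAt E (x t) with hedef
      have he : e ∈ IsManifold.maximalAtlas 𝓘(ℝ, E) ∞ N :=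
        IsManifold.chart_mem_maximalAtlas (I := 𝓘(ℝ, E)) (n := ∞) (x t)
      have hte : x t ∈ e.source := mem_chart_source E (x t)
      set e' := chartAt E' (i (x t)) with hedef'
      have he' : e' ∈ IsManifold.maximalAtlas 𝓘(ℝ, E') ∞ Q :=
        IsManifold.chart_mem_maximalAtlas (I := 𝓘(ℝ, E')) (n := ∞) (i (x t))
      have hte' : i (x t) ∈ e'.source := mem_chart_source E' (i (x t))
      obtain ⟨D, hD⟩ : ∃ D, HasDerivAt (dLdv L' e' fun t => i (x t)) D t :=
        ⟨_, ((contDiffAt_dLdv hL' (hqt t ht) he' hte').differentiableAt one_ne_zero).hasDerivAt⟩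
      set F := D - dLdx L' e' (fun t => i (x t)) t with hF
      have hD' : HasDerivAt (dLdv L' e' fun t => i (x t))
          (dLdx L' e' (fun t => i (x t)) t + F) t := hD.congr_deriv (by rw [hF]; abel)
      -- The intrinsic momentum has derivative ∂L/∂x plus the pullback of F by naturality, and ∂L/∂x
      -- by hypothesis; hence F vanishes on the tangent directions of N.
      have h1 := (hasDerivAt_dLdv_pullback hL' hi hLL' (hxt t ht) he hte he' hte' hD').unique
        (h t ht e he hte)
      obtain ⟨c, hc⟩ := exists_eq_sum_of_comp_eq_zero
        (fderiv_writtenInCharts_injective hi (hret (x t)) he hte he' hte')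
        (linearIndependent_dFun hφ (hindep (x t)) he' hte')
        (hdφ e he e' he' (x t) hte hte') hk (add_eq_left.1 h1)
      -- The sign is due to the convention that the multipliers enter the force as -Λ_α dφ^α.
      refine ⟨-c, fun _ e'' he'' hte'' => constrained_of_chart hL' hφ (hqt t ht) he'' hte'' he' hte'
        (hD'.congr_deriv ?_)⟩
      rw [hc, sub_eq_add_neg, ← Finset.sum_neg_distrib]
      congr 1
      refine Finset.sum_congr rfl fun α _ => ?_
      rw [Pi.neg_apply]
      exact (neg_neg (c α • dFun (φ α) e' (i (x t)))).symm.trans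
        (congrArg Neg.neg (neg_smul (c α) (dFun (φ α) e' (i (x t)))).symm)
    choose Λ hΛ using hpt
    exact ⟨Λ, fun t ht => ⟨hφi (x t), hΛ t ht⟩⟩
  · rintro ⟨Λ, h⟩ t ht e he hte
    have he' := IsManifold.chart_mem_maximalAtlas (I := 𝓘(ℝ, E')) (n := ∞) (i (x t))
    have hte' := mem_chart_source E' (i (x t))
    have h1 := hasDerivAt_dLdv_pullback hL' hi hLL' (hxt t ht) he hte he' hte'
      (((h t ht).2 _ he' hte').congr_deriv (sub_eq_add_neg _ _))
    refine h1.congr_deriv ?_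
    rw [ContinuousLinearMap.neg_comp, ContinuousLinearMap.finsetSum_comp, add_eq_left, neg_eq_zero]
    refine Finset.sum_eq_zero fun α _ => ?_
    rw [ContinuousLinearMap.smul_comp, hdφ e he _ he' (x t) hte hte' α, smul_zero]

end Submanifold


/-! ### Hamilton's principle -/

section Variation

variable {E : Type*} [NormedAddCommGroup E] [NormedSpace ℝ E]

theorem deriv_snd_eq_fderiv {Y : ℝ × ℝ → E} {z : ℝ × ℝ} (hY : DifferentiableAt ℝ Y z) :
    deriv (fun t => Y (z.1, t)) z.2 = fderiv ℝ Y z (0, 1) :=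
  (hY.hasFDerivAt.comp_hasDerivAt (f := fun t => (z.1, t)) z.2
    ((hasDerivAt_const z.2 z.1).prodMk (hasDerivAt_id z.2))).deriv

theorem deriv_fst_eq_fderiv {Y : ℝ × ℝ → E} {z : ℝ × ℝ} (hY : DifferentiableAt ℝ Y z) :
    deriv (fun s => Y (s, z.2)) z.1 = fderiv ℝ Y z (1, 0) :=
  (hY.hasFDerivAt.comp_hasDerivAt (f := fun s => (s, z.2)) z.1
    ((hasDerivAt_id z.1).prodMk (hasDerivAt_const z.1 z.2))).deriv

theorem contDiffAt_fderiv_apply {Y : ℝ × ℝ → E} {z : ℝ × ℝ} (hY : ContDiffAt ℝ 2 Y z)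
    (d : ℝ × ℝ) : ContDiffAt ℝ 1 (fun z => fderiv ℝ Y z d) z :=
  (hY.fderiv_right (m := 1) (by norm_num)).clm_apply contDiffAt_const

theorem contDiffAt_lagrangian_along {ℓ : E → E → ℝ} {Y : ℝ × ℝ → E} {z : ℝ × ℝ}
    (hY : ContDiffAt ℝ 2 Y z)
    (hℓ : ContDiffAt ℝ ∞ (fun z : E × E => ℓ z.1 z.2) (Y z, fderiv ℝ Y z (0, 1))) :
    ContDiffAt ℝ 1 (fun z => ℓ (Y z) (fderiv ℝ Y z (0, 1))) z :=
  ContDiffAt.comp z (f := fun z => (Y z, fderiv ℝ Y z (0, 1)))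
    (hℓ.of_le (mod_cast le_top))
    ((hY.of_le (by norm_num)).prodMk (contDiffAt_fderiv_apply hY (0, 1)))

/-- The first variation formula on a normed space. -/
theorem hasDerivAt_momentum_variation {ℓ : E → E → ℝ} {Y : ℝ × ℝ → E} {s t : ℝ}
    (hY : ContDiffAt ℝ 2 Y (s, t))
    (hℓ : ContDiffAt ℝ ∞ (fun z : E × E => ℓ z.1 z.2) (Y (s, t), fderiv ℝ Y (s, t) (0, 1)))
    {g : E →L[ℝ] ℝ}
    (hg : HasDerivAt (fun t => fiberDeriv ℓ (Y (s, t), fderiv ℝ Y (s, t) (0, 1)))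
      (baseDeriv ℓ (Y (s, t), fderiv ℝ Y (s, t) (0, 1)) + g) t) :
    HasDerivAt (fun t => fiberDeriv ℓ (Y (s, t), fderiv ℝ Y (s, t) (0, 1))
        (fderiv ℝ Y (s, t) (1, 0)))
      (fderiv ℝ (fun z => ℓ (Y z) (fderiv ℝ Y z (0, 1))) (s, t) (1, 0) +
        g (fderiv ℝ Y (s, t) (1, 0))) t := by
  have hDY : HasFDerivAt (fderiv ℝ Y) (fderiv ℝ (fderiv ℝ Y) (s, t)) (s, t) :=
    ((hY.fderiv_right (m := 1) (by norm_num)).differentiableAt one_ne_zero).hasFDerivAt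
  have h1 : HasDerivAt (fun t => fderiv ℝ Y (s, t) (1, 0))
      (fderiv ℝ (fderiv ℝ Y) (s, t) (0, 1) (1, 0)) t := by
    have := hDY.comp_hasDerivAt (f := fun t => (s, t)) t
      ((hasDerivAt_const t s).prodMk (hasDerivAt_id t))
    simpa using this.clm_apply (hasDerivAt_const t ((1 : ℝ), (0 : ℝ)))
  have h2 : HasFDerivAt (fun z => fderiv ℝ Y z (0, 1))
      ((fderiv ℝ (fderiv ℝ Y) (s, t)).flip (0, 1)) (s, t) := by
    simpa using hDY.clm_apply (hasFDerivAt_const ((0 : ℝ), (1 : ℝ)) (s, t))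
  have hℓd : DifferentiableAt ℝ (fun z : E × E => ℓ z.1 z.2)
      (Y (s, t), fderiv ℝ Y (s, t) (0, 1)) := hℓ.differentiableAt (by simp)
  have h3 := hℓd.hasFDerivAt.comp (f := fun z => (Y z, fderiv ℝ Y z (0, 1))) (s, t)
    ((hY.differentiableAt (by norm_num)).hasFDerivAt.prodMk h2)
  have h4 : fderiv ℝ (fun z => ℓ (Y z) (fderiv ℝ Y z (0, 1))) (s, t) (1, 0) =
      baseDeriv ℓ (Y (s, t), fderiv ℝ Y (s, t) (0, 1)) (fderiv ℝ Y (s, t) (1, 0)) +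
      fiberDeriv ℓ (Y (s, t), fderiv ℝ Y (s, t) (0, 1))
        (fderiv ℝ (fderiv ℝ Y) (s, t) (1, 0) (0, 1)) := by
    refine (congrArg (fun A : ℝ × ℝ →L[ℝ] ℝ => A (1, 0)) h3.fderiv).trans ?_
    exact fderiv_lagrangian_apply hℓd _ _
  -- The time derivative of the variation field is the variation of the velocity, by equality of
  -- mixed partials.
  have h5 := (hY.isSymmSndFDerivAt
    (by rw [minSmoothness_of_isRCLikeNormedField])).eq (1, 0) (0, 1)
  refine (hg.clm_apply h1).congr_deriv ?_
  rw [h4, h5]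
  simp only [add_apply]
  ring

/-- Differentiation under the integral sign for `C¹` functions. -/
theorem hasDerivAt_integral_of_contDiffAt {G : ℝ × ℝ → ℝ} {ε a b : ℝ} (hε : 0 < ε) (hab : a < b)
    (hG : ∀ z ∈ Ioo (-ε) ε ×ˢ Icc a b, ContDiffAt ℝ 1 G z) :
    IntervalIntegrable (fun t => fderiv ℝ G (0, t) (1, 0)) MeasureTheory.volume a b ∧
    HasDerivAt (fun s => ∫ t in a..b, G (s, t)) (∫ t in a..b, fderiv ℝ G (0, t) (1, 0)) 0 := by
  have hcont : ∀ s ∈ Ioo (-ε) ε, ContinuousOn (fun t => G (s, t)) (Icc a b) := by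
    intro s hs t ht
    have h1 : ContinuousAt (fun t : ℝ => (s, t)) t := by fun_prop
    exact ((hG (s, t) ⟨hs, ht⟩).continuousAt.comp (f := fun t : ℝ => (s, t)) h1).continuousWithinAt
  have hder : ContinuousOn (fun z => fderiv ℝ G z (1, 0)) (Ioo (-ε) ε ×ˢ Icc a b) := by
    intro z hz
    exact (((hG z hz).fderiv_right (m := 0) (by norm_num)).continuousAt.clm_apply
      continuousAt_const).continuousWithinAt
  have hder0 : ContinuousOn (fun t => fderiv ℝ G (0, t) (1, 0)) (Icc a b) :=
    hder.comp (f := fun t : ℝ => ((0 : ℝ), t)) (by fun_prop)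
      fun t ht => ⟨⟨by linarith, hε⟩, ht⟩
  -- Halving ε gives a compact rectangle, on which the s-derivative is bounded by a constant that
  -- dominates it.
  have hsub : Icc (-(ε / 2)) (ε / 2) ×ˢ Icc a b ⊆ Ioo (-ε) ε ×ˢ Icc a b :=
    prod_mono (Icc_subset_Ioo (by linarith) (by linarith)) subset_rfl
  obtain ⟨C, hC⟩ := (isCompact_Icc.prod isCompact_Icc).exists_bound_of_continuousOn
    (hder.mono hsub)
  have huIcc : uIcc a b = Icc a b := uIcc_of_le hab.le
  have huIoc : uIoc a b ⊆ Icc a b := by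
    rw [uIoc_of_le hab.le]
    exact Ioc_subset_Icc_self
  have hmeas : ∀ f : ℝ → ℝ, ContinuousOn f (Icc a b) →
      MeasureTheory.AEStronglyMeasurable f (MeasureTheory.volume.restrict (uIoc a b)) :=
    fun f hf => (hf.mono huIoc).aestronglyMeasurable measurableSet_uIoc
  refine intervalIntegral.hasDerivAt_integral_of_dominated_loc_of_deriv_le
    (F := fun s t => G (s, t)) (F' := fun s t => fderiv ℝ G (s, t) (1, 0)) (bound := fun _ => C)
    (s := Icc (-(ε / 2)) (ε / 2)) (Icc_mem_nhds (by linarith) (by linarith)) ?_ ?_ ?_ ?_ ?_ ?_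
  · filter_upwards [Ioo_mem_nhds (show -ε < 0 by linarith) hε] with s hs
    exact hmeas _ (hcont s hs)
  · exact ContinuousOn.intervalIntegrable (huIcc ▸ hcont 0 ⟨by linarith, hε⟩)
  · exact hmeas _ hder0
  · exact Filter.Eventually.of_forall fun t ht s hs => hC (s, t) ⟨hs, huIoc ht⟩
  · exact intervalIntegrable_const
  · refine Filter.Eventually.of_forall fun t ht s hs => ?_
    have h1 := (hG (s, t) (hsub ⟨hs, huIoc ht⟩)).differentiableAt one_ne_zero
    exact h1.hasFDerivAt.comp_hasDerivAt (f := fun s => (s, t)) s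
      ((hasDerivAt_id s).prodMk (hasDerivAt_const s t))

end Variation

/-! ### First variation on a manifold; Euler-Lagrange curves are critical -/

section Manifold

variable {E : Type*} [NormedAddCommGroup E] [NormedSpace ℝ E]
  {M : Type*} [TopologicalSpace M] [ChartedSpace E M]
  {e : OpenPartialHomeomorph M E} {L : TangentBundle 𝓘(ℝ, E) M → ℝ} {X : ℝ → ℝ → M}

/-- The pairing of the momentum of the curve `X 0` with the variation field of `X`. -/
def variationMomentum (L : TangentBundle 𝓘(ℝ, E) M → ℝ) (X : ℝ → ℝ → M) (t : ℝ) : ℝ :=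
  (legendreMap L (velocityLift (X 0) t)).2
    (mfderiv 𝓘(ℝ, ℝ × ℝ) 𝓘(ℝ, E) (fun z : ℝ × ℝ => X z.1 z.2) (0, t) ((1, 0) : ℝ × ℝ))

theorem contMDiffAt_variation_right {n : WithTop ℕ∞} {z : ℝ × ℝ}
    (hX : ContMDiffAt 𝓘(ℝ, ℝ × ℝ) 𝓘(ℝ, E) n (fun z : ℝ × ℝ => X z.1 z.2) z) :
    ContMDiffAt 𝓘(ℝ, ℝ) 𝓘(ℝ, E) n (X z.1) z.2 := by
  have h1 : ContMDiffAt 𝓘(ℝ, ℝ) 𝓘(ℝ, ℝ × ℝ) n (fun t : ℝ => (z.1, t)) z.2 :=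
    (contDiffAt_const.prodMk contDiffAt_id).contMDiffAt
  exact ContMDiffAt.comp z.2 (g := fun z : ℝ × ℝ => X z.1 z.2) hX h1

theorem deriv_chart_variation {z : ℝ × ℝ}
    (hX : ContMDiffAt 𝓘(ℝ, ℝ × ℝ) 𝓘(ℝ, E) 2 (fun z : ℝ × ℝ => X z.1 z.2) z)
    (he : e ∈ IsManifold.maximalAtlas 𝓘(ℝ, E) ∞ M) (hz : X z.1 z.2 ∈ e.source) :
    deriv (fun t => e (X z.1 t)) z.2 = fderiv ℝ (fun z : ℝ × ℝ => e (X z.1 z.2)) z (0, 1) :=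
  deriv_snd_eq_fderiv (Y := fun z : ℝ × ℝ => e (X z.1 z.2))
    ((contDiffAt_chart_comp (x := fun z : ℝ × ℝ => X z.1 z.2) ENat.LEInfty.out hX he
      hz).differentiableAt (by norm_num))

theorem dLdv_variation {s t : ℝ}
    (hX : ContMDiffAt 𝓘(ℝ, ℝ × ℝ) 𝓘(ℝ, E) 2 (fun z : ℝ × ℝ => X z.1 z.2) (s, t))
    (he : e ∈ IsManifold.maximalAtlas 𝓘(ℝ, E) ∞ M) (hz : X s t ∈ e.source) :
    dLdv L e (X s) t = fiberDeriv (localLagrangian L e)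
      (e (X s t), fderiv ℝ (fun z : ℝ × ℝ => e (X z.1 z.2)) (s, t) (0, 1)) := by
  rw [← deriv_chart_variation hX he hz]
  rfl

theorem dLdx_variation {s t : ℝ}
    (hX : ContMDiffAt 𝓘(ℝ, ℝ × ℝ) 𝓘(ℝ, E) 2 (fun z : ℝ × ℝ => X z.1 z.2) (s, t))
    (he : e ∈ IsManifold.maximalAtlas 𝓘(ℝ, E) ∞ M) (hz : X s t ∈ e.source) :
    dLdx L e (X s) t = baseDeriv (localLagrangian L e)
      (e (X s t), fderiv ℝ (fun z : ℝ × ℝ => e (X z.1 z.2)) (s, t) (0, 1)) := by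
  rw [← deriv_chart_variation hX he hz]
  rfl

theorem eventually_lagrangian_variation {W : Set (ℝ × ℝ)} (hW : IsOpen W)
    (hX : ContMDiffOn 𝓘(ℝ, ℝ × ℝ) 𝓘(ℝ, E) 2 (fun z : ℝ × ℝ => X z.1 z.2) W)
    (he : e ∈ IsManifold.maximalAtlas 𝓘(ℝ, E) ∞ M) {z : ℝ × ℝ} (hzW : z ∈ W)
    (hz : X z.1 z.2 ∈ e.source) :
    (fun z : ℝ × ℝ => L (velocityLift (X z.1) z.2)) =ᶠ[𝓝 z] fun z =>
      localLagrangian L e (e (X z.1 z.2))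
        (fderiv ℝ (fun z : ℝ × ℝ => e (X z.1 z.2)) z (0, 1)) := by
  filter_upwards [hW.mem_nhds hzW, (hX.contMDiffAt (hW.mem_nhds hzW)).continuousAt.preimage_mem_nhds
    (e.open_source.mem_nhds hz)] with z' hz' hze
  have h1 := hX.contMDiffAt (hW.mem_nhds hz')
  rw [lagrangian_velocityLift L ((contMDiffAt_variation_right h1).mdifferentiableAt (by norm_num))
    he hze, deriv_chart_variation h1 he hze]

theorem IsEulerLagrange.congr {I : Set ℝ} (hI : IsOpen I) {x y : ℝ → M}
    (h : IsEulerLagrange L I x) (hxy : ∀ t ∈ I, x t = y t) : IsEulerLagrange L I y := by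
  rw [isEulerLagrange_iff_zero L I _ Fin.elim0 fun _ => Fin.elim0] at h ⊢
  exact h.congr hI hxy fun _ _ => rfl

variable [IsManifold 𝓘(ℝ, E) ∞ M]

theorem variationMomentum_eq (hL : ContMDiff 𝓘(ℝ, E).tangent 𝓘(ℝ, ℝ) ∞ L) {t : ℝ}
    (hX : ContMDiffAt 𝓘(ℝ, ℝ × ℝ) 𝓘(ℝ, E) 2 (fun z : ℝ × ℝ => X z.1 z.2) (0, t))
    (he : e ∈ IsManifold.maximalAtlas 𝓘(ℝ, E) ∞ M) (ht : X 0 t ∈ e.source) :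
    variationMomentum L X t = dLdv L e (X 0) t
      (fderiv ℝ (fun z : ℝ × ℝ => e (X z.1 z.2)) (0, t) (1, 0)) := by
  have h1 := legendreMap_snd hL he (v := velocityLift (X 0) t) ht
  rw [velocityCoord_velocityLift ((contMDiffAt_variation_right hX).mdifferentiableAt
    (by norm_num)) he ht] at h1
  have h2 := mfderiv_comp (I := 𝓘(ℝ, ℝ × ℝ)) (I' := 𝓘(ℝ, E)) (I'' := 𝓘(ℝ, E)) (0, t)
    (f := fun z : ℝ × ℝ => X z.1 z.2) (g := e)
    ((mdifferentiable_of_mem_maximalAtlas he).mdifferentiableAt ht)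
    (hX.mdifferentiableAt (by norm_num))
  have h3 : fderiv ℝ (fun z : ℝ × ℝ => e (X z.1 z.2)) (0, t) (1, 0) =
      mfderiv 𝓘(ℝ, E) 𝓘(ℝ, E) e (X 0 t)
        (mfderiv 𝓘(ℝ, ℝ × ℝ) 𝓘(ℝ, E) (fun z : ℝ × ℝ => X z.1 z.2) (0, t) ((1, 0) : ℝ × ℝ)) :=
    (congrArg (fun A : ℝ × ℝ →L[ℝ] E => A (1, 0))
      (mfderiv_eq_fderiv (𝕜 := ℝ) (f := fun z : ℝ × ℝ => e (X z.1 z.2)) (x := (0, t)))).symm.trans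
      (congrArg (fun A : ℝ × ℝ →L[ℝ] E => A (1, 0)) h2)
  rw [h3]
  exact congrArg (fun A : E →L[ℝ] ℝ => A
    (mfderiv 𝓘(ℝ, ℝ × ℝ) 𝓘(ℝ, E) (fun z : ℝ × ℝ => X z.1 z.2) (0, t) ((1, 0) : ℝ × ℝ))) h1

theorem contDiffAt_lagrangian_variation (hL : ContMDiff 𝓘(ℝ, E).tangent 𝓘(ℝ, ℝ) ∞ L)
    {W : Set (ℝ × ℝ)} (hW : IsOpen W)
    (hX : ContMDiffOn 𝓘(ℝ, ℝ × ℝ) 𝓘(ℝ, E) 2 (fun z : ℝ × ℝ => X z.1 z.2) W) {z : ℝ × ℝ}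
    (hz : z ∈ W) : ContDiffAt ℝ 1 (fun z : ℝ × ℝ => L (velocityLift (X z.1) z.2)) z := by
  have he := IsManifold.chart_mem_maximalAtlas (I := 𝓘(ℝ, E)) (n := ∞) (X z.1 z.2)
  have hze := mem_chart_source E (X z.1 z.2)
  refine ContDiffAt.congr_of_eventuallyEq ?_ (eventually_lagrangian_variation hW hX he hz hze)
  exact contDiffAt_lagrangian_along
    (contDiffAt_chart_comp (x := fun z : ℝ × ℝ => X z.1 z.2) ENat.LEInfty.out
      (hX.contMDiffAt (hW.mem_nhds hz)) he hze)
    (contDiffAt_localLagrangian hL he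
      ((chartAt E (X z.1 z.2)).map_source hze))

/-- The first variation formula. -/
theorem hasDerivAt_variationMomentum (hL : ContMDiff 𝓘(ℝ, E).tangent 𝓘(ℝ, ℝ) ∞ L)
    {W : Set (ℝ × ℝ)} (hW : IsOpen W)
    (hX : ContMDiffOn 𝓘(ℝ, ℝ × ℝ) 𝓘(ℝ, E) 2 (fun z : ℝ × ℝ => X z.1 z.2) W) {t : ℝ}
    (hz : (0, t) ∈ W) (he : e ∈ IsManifold.maximalAtlas 𝓘(ℝ, E) ∞ M) (ht : X 0 t ∈ e.source)
    {g : E →L[ℝ] ℝ} (hg : HasDerivAt (dLdv L e (X 0)) (dLdx L e (X 0) t + g) t) :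
    HasDerivAt (variationMomentum L X)
      (fderiv ℝ (fun z : ℝ × ℝ => L (velocityLift (X z.1) z.2)) (0, t) (1, 0) +
        g (fderiv ℝ (fun z : ℝ × ℝ => e (X z.1 z.2)) (0, t) (1, 0))) t := by
  have hXt := hX.contMDiffAt (hW.mem_nhds hz)
  have hev : ∀ᶠ t' in 𝓝 t, (0, t') ∈ W ∧ X 0 t' ∈ e.source := by
    have h1 : ContinuousAt (fun t' : ℝ => ((0 : ℝ), t')) t := by fun_prop
    exact Filter.inter_mem (h1.preimage_mem_nhds (hW.mem_nhds hz))
      ((contMDiffAt_variation_right hXt).continuousAt.preimage_mem_nhds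
        (e.open_source.mem_nhds ht))
  have h2 : dLdv L e (X 0) =ᶠ[𝓝 t] fun t => fiberDeriv (localLagrangian L e)
      (e (X 0 t), fderiv ℝ (fun z : ℝ × ℝ => e (X z.1 z.2)) (0, t) (0, 1)) := by
    filter_upwards [hev] with t' ht'
    exact dLdv_variation (hX.contMDiffAt (hW.mem_nhds ht'.1)) he ht'.2
  have h3 : variationMomentum L X =ᶠ[𝓝 t] fun t => fiberDeriv (localLagrangian L e)
      (e (X 0 t), fderiv ℝ (fun z : ℝ × ℝ => e (X z.1 z.2)) (0, t) (0, 1))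
      (fderiv ℝ (fun z : ℝ × ℝ => e (X z.1 z.2)) (0, t) (1, 0)) := by
    filter_upwards [hev] with t' ht'
    have h4 := hX.contMDiffAt (hW.mem_nhds ht'.1)
    rw [variationMomentum_eq hL h4 he ht'.2, dLdv_variation h4 he ht'.2]
  rw [dLdx_variation hXt he ht] at hg
  rw [(eventually_lagrangian_variation hW hX he hz ht).fderiv_eq]
  exact (hasDerivAt_momentum_variation (Y := fun z : ℝ × ℝ => e (X z.1 z.2))
    (contDiffAt_chart_comp (x := fun z : ℝ × ℝ => X z.1 z.2) ENat.LEInfty.out hXt he ht)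
    (contDiffAt_localLagrangian hL he (e.map_source ht))
    (hg.congr_of_eventuallyEq h2.symm)).congr_of_eventuallyEq h3

/-- Where the variation does not move the point, its field vanishes; this removes the boundary
terms. -/
theorem variationMomentum_eq_zero (hL : ContMDiff 𝓘(ℝ, E).tangent 𝓘(ℝ, ℝ) ∞ L) {t : ℝ}
    (hX : ContMDiffAt 𝓘(ℝ, ℝ × ℝ) 𝓘(ℝ, E) 2 (fun z : ℝ × ℝ => X z.1 z.2) (0, t)) {p : M}
    (hp : ∀ᶠ s in 𝓝 (0 : ℝ), X s t = p) : variationMomentum L X t = 0 := by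
  have he := IsManifold.chart_mem_maximalAtlas (I := 𝓘(ℝ, E)) (n := ∞) (X 0 t)
  have ht := mem_chart_source E (X 0 t)
  rw [variationMomentum_eq hL hX he ht,
    ← deriv_fst_eq_fderiv (Y := fun z : ℝ × ℝ => chartAt E (X 0 t) (X z.1 z.2)) (z := (0, t))
      ((contDiffAt_chart_comp (x := fun z : ℝ × ℝ => X z.1 z.2) ENat.LEInfty.out hX he
        ht).differentiableAt (by norm_num))]
  have h1 : (fun s => chartAt E (X 0 t) (X s t)) =ᶠ[𝓝 0] fun _ => chartAt E (X 0 t) p :=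
    hp.mono fun s hs => congrArg (chartAt E (X 0 t)) hs
  have h2 : deriv (fun s => chartAt E (X 0 t) (X s t)) 0 = 0 := by
    rw [h1.deriv_eq, deriv_const]
  exact (congrArg (dLdv L (chartAt E (X 0 t)) (X 0) t) h2).trans (map_zero _)

/-- Solutions of the Euler-Lagrange equations are critical curves. -/
theorem IsEulerLagrange.isCriticalCurve (hL : ContMDiff 𝓘(ℝ, E).tangent 𝓘(ℝ, ℝ) ∞ L) {I : Set ℝ}
    (hI : IsOpen I) {x : ℝ → M} (h : IsEulerLagrange L I x) : IsCriticalCurve L I x := by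
  intro a b hab habI ε X hε hX hX0 hends
  have hEL : IsEulerLagrange L I (X 0) := h.congr hI fun t ht => (hX0 t ht).symm
  have hW : IsOpen (Ioo (-ε) ε ×ˢ I) := isOpen_Ioo.prod hI
  have h0 : (0 : ℝ) ∈ Ioo (-ε) ε := ⟨by linarith, hε⟩
  obtain ⟨hint, hder⟩ := hasDerivAt_integral_of_contDiffAt hε hab
    (G := fun z : ℝ × ℝ => L (velocityLift (X z.1) z.2))
    fun z hz => contDiffAt_lagrangian_variation hL hW hX ⟨hz.1, habI hz.2⟩
  -- On a solution the residual is g = 0, so the variation of L is an exact time derivative.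
  have hmom : ∀ t ∈ uIcc a b, HasDerivAt (variationMomentum L X)
      (fderiv ℝ (fun z : ℝ × ℝ => L (velocityLift (X z.1) z.2)) (0, t) (1, 0)) t := by
    intro t ht
    rw [uIcc_of_le hab.le] at ht
    have he := IsManifold.chart_mem_maximalAtlas (I := 𝓘(ℝ, E)) (n := ∞) (X 0 t)
    have hte := mem_chart_source E (X 0 t)
    simpa using hasDerivAt_variationMomentum hL hW hX ⟨h0, habI ht⟩ he hte (g := 0)
      ((hEL t (habI ht) _ he hte).congr_deriv (add_zero _).symm)
  have hX' : ∀ t ∈ I, ContMDiffAt 𝓘(ℝ, ℝ × ℝ) 𝓘(ℝ, E) 2 (fun z : ℝ × ℝ => X z.1 z.2) (0, t) :=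
    fun t ht => hX.contMDiffAt (hW.mem_nhds ⟨h0, ht⟩)
  have hnhds : Ioo (-ε) ε ∈ 𝓝 (0 : ℝ) := Ioo_mem_nhds h0.1 h0.2
  have hval : ∫ t in a..b, fderiv ℝ (fun z : ℝ × ℝ => L (velocityLift (X z.1) z.2)) (0, t) (1, 0)
      = 0 := by
    rw [intervalIntegral.integral_eq_sub_of_hasDerivAt hmom hint,
      variationMomentum_eq_zero hL (hX' a (habI (left_mem_Icc.2 hab.le)))
        (Filter.eventually_of_mem hnhds fun s hs => (hends s hs).1),
      variationMomentum_eq_zero hL (hX' b (habI (right_mem_Icc.2 hab.le)))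
        (Filter.eventually_of_mem hnhds fun s hs => (hends s hs).2), sub_zero]
  exact hder.congr_deriv hval

end Manifold


/-! ### Critical curves satisfy the Euler-Lagrange equations -/

section Critical

variable {E : Type*} [NormedAddCommGroup E] [NormedSpace ℝ E]
  {M : Type*} [TopologicalSpace M] [ChartedSpace E M]
  {L : TangentBundle 𝓘(ℝ, E) M → ℝ}

/-- A variation with fixed end points of a curve, supported in a chart. -/
theorem exists_variation_in_chart {e : OpenPartialHomeomorph M E}
    (he : e ∈ IsManifold.maximalAtlas 𝓘(ℝ, E) ∞ M) {I : Set ℝ} (hI : IsOpen I) {x : ℝ → M}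
    (hx : ContMDiffOn 𝓘(ℝ, ℝ) 𝓘(ℝ, E) 2 x I) {a b c d : ℝ} (hac : a < c) (hdb : d < b)
    (habI : Icc a b ⊆ I) (hab : ∀ t ∈ Icc a b, x t ∈ e.source) {ρ : ℝ → ℝ}
    (hρ : ContDiff ℝ 2 ρ) (hρ0 : ∀ t ∉ Icc c d, ρ t = 0) (u : E) :
    ∃ (ε : ℝ) (X : ℝ → ℝ → M), 0 < ε ∧
      ContMDiffOn 𝓘(ℝ, ℝ × ℝ) 𝓘(ℝ, E) 2 (fun z : ℝ × ℝ => X z.1 z.2) (Ioo (-ε) ε ×ˢ I) ∧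
      (∀ t ∈ I, X 0 t = x t) ∧ (∀ s ∈ Ioo (-ε) ε, X s a = x a ∧ X s b = x b) ∧
      ∀ s ∈ Ioo (-ε) ε, ∀ t ∈ Icc a b, e (X s t) = e (x t) + (s * ρ t) • u := by
  classical
  set J : Set ℝ := I ∩ x ⁻¹' e.source with hJ
  have hJo : IsOpen J := hx.continuousOn.isOpen_inter_preimage hI e.open_source
  have habJ : Icc a b ⊆ J := fun t ht => ⟨habI ht, hab t ht⟩
  set Z : ℝ × ℝ → E := fun z => e (x z.2) + (z.1 * ρ z.2) • u with hZ
  have hZs : ∀ z : ℝ × ℝ, z.2 ∈ J → ContDiffAt ℝ 2 Z z := by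
    intro z hz
    have h1 : ContDiffAt ℝ 2 (fun t => e (x t)) z.2 :=
      contDiffAt_chart_comp ENat.LEInfty.out (hx.contMDiffAt (hI.mem_nhds hz.1)) he hz.2
    have h2 : ContDiffAt ℝ 2 (fun z : ℝ × ℝ => ρ z.2) z := (hρ.comp contDiff_snd).contDiffAt
    exact (h1.comp z contDiffAt_snd).add ((contDiffAt_fst.mul h2).smul contDiffAt_const)
  have hO : IsOpen ((univ ×ˢ J) ∩ Z ⁻¹' e.target) := by
    refine ContinuousOn.isOpen_inter_preimage ?_ (isOpen_univ.prod hJo) e.open_target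
    exact fun z hz => (hZs z hz.2).continuousAt.continuousWithinAt
  have hsub : ({0} : Set ℝ) ×ˢ Icc a b ⊆ (univ ×ˢ J) ∩ Z ⁻¹' e.target := by
    rintro ⟨s, t⟩ ⟨hs, ht⟩
    rw [mem_singleton_iff] at hs
    simp only at hs
    subst hs
    refine ⟨⟨mem_univ _, habJ ht⟩, ?_⟩
    simpa [hZ] using e.map_source (hab t ht)
  -- Compactness of [a, b] gives one ε for which the displaced curve stays in the chart target at
  -- all its times.
  obtain ⟨S, T, hS, -, hS0, hT, hST⟩ :=
    generalized_tube_lemma isCompact_singleton isCompact_Icc hO hsub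
  obtain ⟨ε, hε, hεS⟩ := Metric.isOpen_iff.1 hS 0 (hS0 rfl)
  rw [Real.ball_eq_Ioo, zero_sub, zero_add] at hεS
  have htarget : ∀ s ∈ Ioo (-ε) ε, ∀ t ∈ Icc a b, Z (s, t) ∈ e.target :=
    fun s hs t ht => (hST (mk_mem_prod (hεS hs) (hT ht))).2
  -- The two formulas agree off [c, d], which lies inside (a, b), so X is C² also across a and b.
  set X : ℝ → ℝ → M := fun s t => if t ∈ Icc a b then e.symm (Z (s, t)) else x t with hX
  have hXin : ∀ s t, t ∈ Icc a b → X s t = e.symm (Z (s, t)) := fun s t ht => if_pos ht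
  have hXout : ∀ s t, t ∉ Icc c d → X s t = x t := by
    intro s t ht
    by_cases ht' : t ∈ Icc a b
    · rw [hXin s t ht', hZ]
      simp [hρ0 t ht, e.left_inv (hab t ht')]
    · exact if_neg ht'
  refine ⟨ε, X, hε, ?_, ?_, ?_, ?_⟩
  · rintro ⟨s, t⟩ ⟨hs, ht⟩
    refine ContMDiffAt.contMDiffWithinAt ?_
    by_cases htab : t ∈ Ioo a b
    · have htab' := Ioo_subset_Icc_self htab
      have h1 : ContMDiffAt 𝓘(ℝ, ℝ × ℝ) 𝓘(ℝ, E) 2 (fun z => e.symm (Z z)) (s, t) :=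
        ((contMDiffAt_symm_of_mem_maximalAtlas he (htarget s hs t htab')).of_le
          ENat.LEInfty.out).comp (s, t) (hZs (s, t) (habJ htab')).contMDiffAt
      refine h1.congr_of_eventuallyEq ?_
      have h2 : ∀ᶠ z : ℝ × ℝ in 𝓝 (s, t), z.2 ∈ Ioo a b :=
        continuousAt_snd.preimage_mem_nhds (isOpen_Ioo.mem_nhds htab)
      filter_upwards [h2] with z hz
      exact hXin z.1 z.2 (Ioo_subset_Icc_self hz)
    · have htcd : t ∉ Icc c d := fun h =>
        htab ⟨hac.trans_le h.1, h.2.trans_lt hdb⟩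
      have h1 : ContMDiffAt 𝓘(ℝ, ℝ × ℝ) 𝓘(ℝ, E) 2 (fun z : ℝ × ℝ => x z.2) (s, t) :=
        ContMDiffAt.comp (s, t) (g := x) (hx.contMDiffAt (hI.mem_nhds ht))
          contDiffAt_snd.contMDiffAt
      refine h1.congr_of_eventuallyEq ?_
      have h2 : ∀ᶠ z : ℝ × ℝ in 𝓝 (s, t), z.2 ∈ (Icc c d)ᶜ :=
        continuousAt_snd.preimage_mem_nhds (isClosed_Icc.isOpen_compl.mem_nhds htcd)
      filter_upwards [h2] with z hz
      exact hXout z.1 z.2 hz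
  · intro t _
    by_cases ht' : t ∈ Icc a b
    · rw [hXin 0 t ht', hZ]
      simp [e.left_inv (hab t ht')]
    · exact if_neg ht'
  · exact fun s _ => ⟨hXout s a fun h => (hac.trans_le h.1).false,
      hXout s b fun h => (h.2.trans_lt hdb).false⟩
  · intro s hs t ht
    rw [hXin s t ht, e.right_inv (htarget s hs t ht)]

variable [IsManifold 𝓘(ℝ, E) ∞ M]

/-- Critical `C²` curves satisfy the Euler-Lagrange equations. -/
theorem IsCriticalCurve.isEulerLagrange (hL : ContMDiff 𝓘(ℝ, E).tangent 𝓘(ℝ, ℝ) ∞ L) {I : Set ℝ}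
    (hI : IsOpen I) {x : ℝ → M} (hx : ContMDiffOn 𝓘(ℝ, ℝ) 𝓘(ℝ, E) 2 x I)
    (h : IsCriticalCurve L I x) : IsEulerLagrange L I x := by
  intro t₀ ht₀ e he hte
  have hxt : ∀ t ∈ I, ContMDiffAt 𝓘(ℝ, ℝ) 𝓘(ℝ, E) 2 x t :=
    fun t ht => hx.contMDiffAt (hI.mem_nhds ht)
  set J : Set ℝ := I ∩ x ⁻¹' e.source with hJ
  have hJo : IsOpen J := hx.continuousOn.isOpen_inter_preimage hI e.open_source
  -- The Euler-Lagrange residual: defined and continuous since x is C², so if nonzero at t₀ it is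
  -- positive on some fixed u throughout an interval.
  set g : ℝ → E →L[ℝ] ℝ := fun t => deriv (dLdv L e x) t - dLdx L e x t with hg
  have hgder : ∀ t ∈ J, HasDerivAt (dLdv L e x) (dLdx L e x t + g t) t := by
    intro t ht
    rw [hg, add_sub_cancel]
    exact ((contDiffAt_dLdv hL (hxt t ht.1) he ht.2).differentiableAt one_ne_zero).hasDerivAt
  have hgc : ∀ t ∈ J, ContinuousAt g t := by
    intro t ht
    have h1 : ContinuousAt (deriv (dLdv L e x)) t := by
      have := (contDiffAt_dLdv hL (hxt t ht.1) he ht.2).fderiv_right (m := 0) (by norm_num)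
      have := (this.clm_apply (contDiffAt_const (c := (1 : ℝ)))).continuousAt
      simpa only [fderiv_apply_one_eq_deriv] using this
    exact h1.sub (continuousAt_dLdx hL (hxt t ht.1) he ht.2)
  suffices hg0 : g t₀ = 0 by simpa [hg0] using hgder t₀ ⟨ht₀, hte⟩
  by_contra hne
  obtain ⟨u, hu⟩ : ∃ u, 0 < g t₀ u := by
    by_contra! hall
    refine hne (ContinuousLinearMap.ext fun u => le_antisymm (hall u) ?_)
    have := hall (-u)
    rw [map_neg] at this
    simpa using this
  have hpos : {t | t ∈ J ∧ 0 < g t u} ∈ 𝓝 t₀ := by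
    have h1 : ContinuousAt (fun t => g t u) t₀ := (hgc t₀ ⟨ht₀, hte⟩).clm_apply continuousAt_const
    exact Filter.inter_mem (hJo.mem_nhds ⟨ht₀, hte⟩) (h1.preimage_mem_nhds (Ioi_mem_nhds hu))
  obtain ⟨δ, hδ, hδsub⟩ := Metric.nhds_basis_closedBall.mem_iff.1 hpos
  rw [Real.closedBall_eq_Icc] at hδsub
  set a := t₀ - δ with ha
  set b := t₀ + δ with hb
  have hab : a < b := by linarith
  -- The outer radius δ / 2 keeps the support strictly inside (a, b) = (t₀ - δ, t₀ + δ).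
  let ρ : ContDiffBump t₀ := ⟨δ / 4, δ / 2, by linarith, by linarith⟩
  obtain ⟨ε, X, hε, hX, hX0, hends, hXe⟩ := exists_variation_in_chart he hI hx
    (a := a) (b := b) (c := t₀ - δ / 2) (d := t₀ + δ / 2) (by linarith) (by linarith)
    (fun t ht => (hδsub ht).1.1) (fun t ht => (hδsub ht).1.2) (ρ := ρ) ρ.contDiff
    (fun t ht => by
      rw [← Real.closedBall_eq_Icc, Metric.mem_closedBall, not_le] at ht
      exact ρ.zero_of_le_dist ht.le) u
  have habI : Icc a b ⊆ I := fun t ht => (hδsub ht).1.1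
  have hW : IsOpen (Ioo (-ε) ε ×ˢ I) := isOpen_Ioo.prod hI
  have h0 : (0 : ℝ) ∈ Ioo (-ε) ε := ⟨by linarith, hε⟩
  have hnhds : Ioo (-ε) ε ∈ 𝓝 (0 : ℝ) := Ioo_mem_nhds h0.1 h0.2
  have hX' : ∀ t ∈ I, ContMDiffAt 𝓘(ℝ, ℝ × ℝ) 𝓘(ℝ, E) 2 (fun z : ℝ × ℝ => X z.1 z.2) (0, t) :=
    fun t ht => hX.contMDiffAt (hW.mem_nhds ⟨h0, ht⟩)
  obtain ⟨hint, hder⟩ := hasDerivAt_integral_of_contDiffAt hε hab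
    (G := fun z : ℝ × ℝ => L (velocityLift (X z.1) z.2))
    fun z hz => contDiffAt_lagrangian_variation hL hW hX ⟨hz.1, habI hz.2⟩
  have hzero := hder.unique (h a b hab habI ε X hε hX hX0 hends)
  have hmom : ∀ t ∈ uIcc a b, HasDerivAt (variationMomentum L X)
      (fderiv ℝ (fun z : ℝ × ℝ => L (velocityLift (X z.1) z.2)) (0, t) (1, 0) +
        ρ t * g t u) t := by
    intro t ht
    rw [uIcc_of_le hab.le] at ht
    have htI := habI ht
    have hte' : X 0 t ∈ e.source := by
      rw [hX0 t htI]
      exact (hδsub ht).1.2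
    have hev : x =ᶠ[𝓝 t] X 0 :=
      Filter.eventually_of_mem (hI.mem_nhds htI) fun s hs => (hX0 s hs).symm
    have h1 := (hgder t (hδsub ht).1).congr_of_eventuallyEq (dLdv_congr L e hev).symm
    rw [dLdx_congr L e hev] at h1
    have h2 := hasDerivAt_variationMomentum hL hW hX ⟨h0, htI⟩ he hte' h1
    have h3 : fderiv ℝ (fun z : ℝ × ℝ => e (X z.1 z.2)) (0, t) (1, 0) = ρ t • u := by
      rw [← deriv_fst_eq_fderiv (Y := fun z : ℝ × ℝ => e (X z.1 z.2)) (z := (0, t))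
        ((contDiffAt_chart_comp (x := fun z : ℝ × ℝ => X z.1 z.2) ENat.LEInfty.out (hX' t htI) he
          hte').differentiableAt (by norm_num))]
      have h4 : (fun s => e (X s t)) =ᶠ[𝓝 0] fun s => e (x t) + (s * ρ t) • u :=
        Filter.eventually_of_mem hnhds fun s hs => hXe s hs t ht
      have h5 : HasDerivAt (fun s : ℝ => e (x t) + (s * ρ t) • u) (ρ t • u) 0 := by
        simpa using (((hasDerivAt_id (0 : ℝ)).mul_const (ρ t)).smul_const u).const_add (e (x t))
      exact h4.deriv_eq.trans h5.deriv
    rw [h3, map_smul, smul_eq_mul] at h2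
    exact h2
  have hcont : ContinuousOn (fun t => ρ t * g t u) (Icc a b) := fun t ht =>
    (ρ.continuous.continuousAt.mul
      ((hgc t (hδsub ht).1).clm_apply continuousAt_const)).continuousWithinAt
  have hint' : IntervalIntegrable (fun t => ρ t * g t u) MeasureTheory.volume a b :=
    ContinuousOn.intervalIntegrable (by rwa [uIcc_of_le hab.le])
  -- The boundary terms vanish and criticality kills the integral of the variation of L, so the
  -- integral of ρ · g(u) is zero, although its integrand is nonnegative and positive at t₀.
  have hval := intervalIntegral.integral_eq_sub_of_hasDerivAt hmom (hint.add hint')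
  rw [intervalIntegral.integral_add hint hint', hzero,
    variationMomentum_eq_zero hL (hX' a (habI (left_mem_Icc.2 hab.le)))
      (Filter.eventually_of_mem hnhds fun s hs => (hends s hs).1),
    variationMomentum_eq_zero hL (hX' b (habI (right_mem_Icc.2 hab.le)))
      (Filter.eventually_of_mem hnhds fun s hs => (hends s hs).2), sub_zero, zero_add] at hval
  have hposint : 0 < ∫ t in a..b, ρ t * g t u := by
    refine intervalIntegral.integral_pos hab hcont
      (fun t ht => mul_nonneg ρ.nonneg (hδsub (Ioc_subset_Icc_self ht)).2.le)
      ⟨t₀, ⟨by linarith, by linarith⟩, ?_⟩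
    rw [ρ.one_of_mem_closedBall (Metric.mem_closedBall_self ρ.rIn_pos.le), one_mul]
    exact hu
  exact hposint.ne' hval

end Critical

end HolonomicDynamics

end

/-! ### Equivalence of intrinsic and extrinsic dynamics -/

theorem mainTheorem4 {n m : ℕ} (hnm : n < m)
    {Q : Type*} [TopologicalSpace Q] [ChartedSpace (EuclideanSpace ℝ (Fin m)) Q]
    [IsManifold 𝓘(ℝ, EuclideanSpace ℝ (Fin m)) ∞ Q]
    {N : Type*} [TopologicalSpace N] [ChartedSpace (EuclideanSpace ℝ (Fin n)) N]
    [IsManifold 𝓘(ℝ, EuclideanSpace ℝ (Fin n)) ∞ N]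
    -- `N` is an embedded submanifold of `Q`, cut out by independent constraints `φ α = 0`
    (i : N → Q)
    (hi : Manifold.IsSmoothEmbedding 𝓘(ℝ, EuclideanSpace ℝ (Fin n))
      𝓘(ℝ, EuclideanSpace ℝ (Fin m)) ∞ i)
    (φ : Fin (m - n) → Q → ℝ)
    (hφ : ∀ α, ContMDiff 𝓘(ℝ, EuclideanSpace ℝ (Fin m)) 𝓘(ℝ, ℝ) ∞ (φ α))
    (hN : range i = {q | ∀ α, φ α q = 0})
    (hindep : ∀ q ∈ range i, LinearIndependent ℝ
      (fun α => differential (EuclideanSpace ℝ (Fin m)) (φ α) q))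
    -- a regular Lagrangian on `TN` and an arbitrary extension to `TQ`
    (L : TangentBundle 𝓘(ℝ, EuclideanSpace ℝ (Fin n)) N → ℝ)
    (hL : ContMDiff 𝓘(ℝ, EuclideanSpace ℝ (Fin n)).tangent 𝓘(ℝ, ℝ) ∞ L)
    (hreg : IsRegularOn L univ)
    (Lext : TangentBundle 𝓘(ℝ, EuclideanSpace ℝ (Fin m)) Q → ℝ)
    (hLext : ContMDiff 𝓘(ℝ, EuclideanSpace ℝ (Fin m)).tangent 𝓘(ℝ, ℝ) ∞ Lext)
    (hext : ∀ v, Lext (tangentMap 𝓘(ℝ, EuclideanSpace ℝ (Fin n))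
      𝓘(ℝ, EuclideanSpace ℝ (Fin m)) i v) = L v)
    -- the time interval
    (I : Set ℝ) (hIopen : IsOpen I) (hIne : I.Nonempty) (hIconn : I.OrdConnected) :
    -- Hamilton's principle on `N` amounts to the Euler-Lagrange equations on `N`
    (∀ x : ℝ → N, ContMDiffOn 𝓘(ℝ, ℝ) 𝓘(ℝ, EuclideanSpace ℝ (Fin n)) 2 x I →
      (IsCriticalCurve L I x ↔ IsEulerLagrange L I x)) ∧
    -- and to Hamilton's equations on `T*N`
    (∀ (U : Set (TangentBundle 𝓘(ℝ, EuclideanSpace ℝ (Fin n)) N))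
      (H : CotangentBundle (EuclideanSpace ℝ (Fin n)) N → ℝ), IsOpen U →
      IsLegendreTransformOn L U H →
      ∀ P : ℝ → CotangentBundle (EuclideanSpace ℝ (Fin n)) N,
        ContMDiffOn 𝓘(ℝ, ℝ) 𝓘(ℝ, EuclideanSpace ℝ (Fin n)) 2 (fun t => (P t).1) I →
        (((∀ t ∈ I, P t ∈ legendreMap L '' U) ∧ IsHamilton H I P) ↔
          ((∀ t ∈ I, velocityLift (fun s => (P s).1) t ∈ U ∧
            P t = legendreMap L (velocityLift (fun s => (P s).1) t)) ∧
          IsEulerLagrange L I (fun t => (P t).1)))) ∧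
    -- a curve in `N` is an intrinsic solution iff it is an extrinsic one
    (∀ x : ℝ → N, ContMDiffOn 𝓘(ℝ, ℝ) 𝓘(ℝ, EuclideanSpace ℝ (Fin n)) 2 x I →
      (IsEulerLagrange L I x ↔
        ∃ Λ : ℝ → Fin (m - n) → ℝ,
          IsConstrainedEulerLagrange Lext φ I (fun t => i (x t)) Λ)) ∧
    -- extrinsic solutions come from intrinsic solutions
    (∀ (q : ℝ → Q) (Λ : ℝ → Fin (m - n) → ℝ),
      ContMDiffOn 𝓘(ℝ, ℝ) 𝓘(ℝ, EuclideanSpace ℝ (Fin m)) 2 q I →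
      IsConstrainedEulerLagrange Lext φ I q Λ →
      ∃ x : ℝ → N, ContMDiffOn 𝓘(ℝ, ℝ) 𝓘(ℝ, EuclideanSpace ℝ (Fin n)) 2 x I ∧
        (∀ t ∈ I, q t = i (x t)) ∧ IsEulerLagrange L I x) ∧
    -- the solution curves in `TN` are the same
    (∀ V : ℝ → TangentBundle 𝓘(ℝ, EuclideanSpace ℝ (Fin n)) N,
      (∃ x : ℝ → N, ContMDiffOn 𝓘(ℝ, ℝ) 𝓘(ℝ, EuclideanSpace ℝ (Fin n)) 2 x I ∧
        IsEulerLagrange L I x ∧ ∀ t ∈ I, V t = velocityLift x t) ↔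
      (∃ (q : ℝ → Q) (Λ : ℝ → Fin (m - n) → ℝ),
        ContMDiffOn 𝓘(ℝ, ℝ) 𝓘(ℝ, EuclideanSpace ℝ (Fin m)) 2 q I ∧
        IsConstrainedEulerLagrange Lext φ I q Λ ∧
        ∀ t ∈ I, tangentMap 𝓘(ℝ, EuclideanSpace ℝ (Fin n))
          𝓘(ℝ, EuclideanSpace ℝ (Fin m)) i (V t) = velocityLift q t)) ∧
    -- the Lagrangian and the Hamiltonian extrinsic equations agree where `Lext` is regular
    (∀ (U : Set (TangentBundle 𝓘(ℝ, EuclideanSpace ℝ (Fin m)) Q))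
      (H : CotangentBundle (EuclideanSpace ℝ (Fin m)) Q → ℝ), IsOpen U →
      IsRegularOn Lext U → IsLegendreTransformOn Lext U H →
      ∀ (P : ℝ → CotangentBundle (EuclideanSpace ℝ (Fin m)) Q) (Λ : ℝ → Fin (m - n) → ℝ),
        ContMDiffOn 𝓘(ℝ, ℝ) 𝓘(ℝ, EuclideanSpace ℝ (Fin m)) 2 (fun t => (P t).1) I →
        (((∀ t ∈ I, P t ∈ legendreMap Lext '' U) ∧ IsConstrainedHamilton H φ I P Λ) ↔
          ((∀ t ∈ I, velocityLift (fun s => (P s).1) t ∈ U ∧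
            P t = legendreMap Lext (velocityLift (fun s => (P s).1) t)) ∧
          IsConstrainedEulerLagrange Lext φ I (fun t => (P t).1) Λ))) ∧
    -- the multipliers: only the combination `Λ = μ' - lam` of the two families is determined
    (∀ q : ℝ → Q, ContMDiffOn 𝓘(ℝ, ℝ) 𝓘(ℝ, EuclideanSpace ℝ (Fin m)) 2 q I →
      (∀ Λ : ℝ → Fin (m - n) → ℝ, IsConstrainedEulerLagrange Lext φ I q Λ →
        ContinuousOn Λ I ∧
        (∀ Λ' : ℝ → Fin (m - n) → ℝ, IsConstrainedEulerLagrange Lext φ I q Λ' → EqOn Λ Λ' I) ∧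
        (∃ lam₁ μ₁ lam₂ μ₂ : ℝ → Fin (m - n) → ℝ,
          IsTwoMultiplierSolution Lext φ I q lam₁ μ₁ ∧
          IsTwoMultiplierSolution Lext φ I q lam₂ μ₂ ∧
          ∀ t ∈ I, lam₁ t ≠ lam₂ t ∧ μ₁ t ≠ μ₂ t)) ∧
      (∀ lam μ : ℝ → Fin (m - n) → ℝ,
        IsTwoMultiplierSolution Lext φ I q lam μ ↔
          (∀ t ∈ I, DifferentiableAt ℝ μ t) ∧
          IsConstrainedEulerLagrange Lext φ I q (fun t => deriv μ t - lam t))) := by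
  classical
  have hret := fun x => exists_localRetraction (hi.isImmersion.isImmersionAt x)
  have hφi : ∀ x α, φ α (i x) = 0 := fun x =>
    (hN ▸ mem_range_self x : i x ∈ {q | ∀ α, φ α q = 0})
  have hindep' : ∀ p, (∀ α, φ α p = 0) →
      LinearIndependent ℝ (fun α => differential (EuclideanSpace ℝ (Fin m)) (φ α) p) :=
    fun p hp => hindep p (hN.symm ▸ hp)
  have hk : Module.finrank ℝ (EuclideanSpace ℝ (Fin m)) =
      Module.finrank ℝ (EuclideanSpace ℝ (Fin n)) + (m - n) := by
    rw [finrank_euclideanSpace_fin, finrank_euclideanSpace_fin]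
    omega
  have hiff := fun (x : ℝ → N)
      (hx : ContMDiffOn 𝓘(ℝ, ℝ) 𝓘(ℝ, EuclideanSpace ℝ (Fin n)) 2 x I) =>
    isEulerLagrange_iff_exists_multiplier hk hi.contMDiff hret hφ hφi
      (fun x => hindep _ (mem_range_self x)) hLext hext hIopen hx
  have hlift : ∀ (q : ℝ → Q) (Λ : ℝ → Fin (m - n) → ℝ),
      ContMDiffOn 𝓘(ℝ, ℝ) 𝓘(ℝ, EuclideanSpace ℝ (Fin m)) 2 q I →
      IsConstrainedEulerLagrange Lext φ I q Λ →
      ∃ x : ℝ → N, ContMDiffOn 𝓘(ℝ, ℝ) 𝓘(ℝ, EuclideanSpace ℝ (Fin n)) 2 x I ∧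
        (∀ t ∈ I, q t = i (x t)) ∧ IsEulerLagrange L I x := by
    intro q Λ hq h
    obtain ⟨x, hx, hqx⟩ := exists_lift_of_mem_range hIopen hIne hi.isEmbedding hret hq
      fun t ht => hN.symm ▸ (h t ht).1
    exact ⟨x, hx, hqx, (hiff x hx).2 ⟨Λ, h.congr hIopen hqx fun _ _ => rfl⟩⟩
  have himd := hi.contMDiff.mdifferentiable (by simp)
  have hvel : ∀ x : ℝ → N, ContMDiffOn 𝓘(ℝ, ℝ) 𝓘(ℝ, EuclideanSpace ℝ (Fin n)) 2 x I → ∀ t ∈ I,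
      velocityLift (fun t => i (x t)) t = tangentMap 𝓘(ℝ, EuclideanSpace ℝ (Fin n))
        𝓘(ℝ, EuclideanSpace ℝ (Fin m)) i (velocityLift x t) := fun x hx t ht =>
    velocityLift_comp (himd _)
      ((hx.contMDiffAt (hIopen.mem_nhds ht)).mdifferentiableAt (by norm_num))
  refine ⟨fun x hx => ⟨fun h => h.isEulerLagrange hL hIopen hx,
      fun h => h.isCriticalCurve hL hIopen⟩,
    fun U H hU hH P hP => isHamilton_iff hL hU (fun v _ => hreg v (mem_univ v)) hH hIopen hP,
    hiff, hlift, fun V => ⟨?_, ?_⟩,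
    fun U H hU hregU hH P Λ hP => isConstrainedHamilton_iff hLext hU hregU hH φ hIopen hP Λ,
    fun q hq => ⟨fun Λ h => ⟨h.continuousOn_multiplier hLext hφ hindep' hIopen hq,
      fun Λ' h' => h.multiplier_unique hφ hindep' h',
      h.exists_two_pairs (Nat.sub_pos_of_lt hnm) hLext hφ hindep' hIopen hq⟩,
      fun lam μ => isTwoMultiplierSolution_iff hLext hφ hindep' hIopen hq lam μ⟩⟩
  · rintro ⟨x, hx, h, hV⟩
    obtain ⟨Λ, hΛ⟩ := (hiff x hx).1 h
    exact ⟨fun t => i (x t), Λ,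
      (hi.contMDiff.of_le ENat.LEInfty.out).comp_contMDiffOn hx, hΛ,
      fun t ht => by rw [hV t ht, hvel x hx t ht]⟩
  · rintro ⟨q, Λ, hq, h, hV⟩
    obtain ⟨x, hx, hqx, hEL⟩ := hlift q Λ hq h
    refine ⟨x, hx, hEL, fun t ht => ?_⟩
    have hev : q =ᶠ[𝓝 t] fun t => i (x t) := Filter.eventually_of_mem (hIopen.mem_nhds ht) hqx
    have h1 := hV t ht
    rw [velocityLift_congr hev, hvel x hx t ht] at h1
    -- V and the lift of x have the same image under Ti, which is injective because i and its
    -- differentials are.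
    exact tangentMap_injective hi.isEmbedding.injective
      (fun y => mfderiv_injective_of_localRetraction (himd y) (hret y)) h1
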